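/- Let $n, d\ge 1$ and $0\le r\le n$ be integers. Write $S^d(\mathbb{C}^n)$ for the space of forms of degree $d$ in $n$ variables. For a linear form $\ell\in S^1(\mathbb{C}^n)$ and a quadratic form $q\in S^2(\mathbb{C}^n)$, let $s_d(\ell,q)\in S^d(\mathbb{C}^n)$ be the homogeneous part of degree $d$ of the formal power series $\exp(\ell+q/2)$, and let $$\mathrm{GM}_{d,r}(\mathbb{C}^n)\subseteq S^d(\mathbb{C}^n)$$ be the Zariski closure of $\{s_d(\ell,q)\mid \ell\in S^1(\mathbb{C}^n),\ q\in S^2(\mathbb{C}^n),\ \operatorname{rk} q\le r\}$. For a Zariski closed subset $V$ of a finite-dimensional complex vector space $\mathcal L$, let $\sigma_m V$ be the Zariski closure of $\{x_1+\dots+x_m\mid x_1,\dots,x_m\in V\}$ (so $\sigma_0V=\{0\}$). Call $V$ $m$-nondefective if $\dim\sigma_mV=\min\{m\dim V,\dim\mathcal L\}$, and call the least $m$ with $\sigma_mV=\mathcal L$ the generic rank of $\mathcal L$ with respect to $V$. Put $M_r:=(r+1)n-\binom r2$. Then: 1. $\mathrm{GM}_{d,r}(\mathbb{C}^n)$ is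 $m$-nondefective for every integer $m\ge 0$ with $$m\le\frac{\dim S^d(\mathbb{C}^n)}{M_r}-M_r .$$ 2. The generic rank of $S^d(\mathbb{C}^n)$ with respect to $\mathrm{GM}_{d,r}(\mathbb{C}^n)$ exists and is at most $$\frac{\dim S^d(\mathbb{C}^n)}{M_r}+M_r .$$ -/

import Mathlib

namespace GaussianMoments

open MvPolynomial

section Varieties

variable {W : Type*} [AddCommGroup W] [Module ℂ W]

/-- The coordinate ring `ℂ[S]` of a subset `S` of a complex vector space `W`: the polynomial
functions on `W` restricted to `S`, i.e. the algebra of functions on `S` generated by the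
restrictions of the linear functionals on `W`. -/
def coordinateRing (S : Set W) : Subalgebra ℂ (S → ℂ) :=
  Algebra.adjoin ℂ (Set.range fun (φ : Module.Dual ℂ W) (s : S) => φ s)

variable (W) in
/-- The algebra `ℂ[W]` of polynomial functions on a complex vector space `W`. -/
def polynomialFunctions : Subalgebra ℂ (W → ℂ) :=
  Algebra.adjoin ℂ (Set.range fun (φ : Module.Dual ℂ W) (w : W) => φ w)

/-- The Zariski closure of `S`: the points at which every polynomial function that vanishes
on `S` vanishes. -/
def zariskiClosure (S : Set W) : Set W :=
  {w | ∀ f ∈ polynomialFunctions W, (∀ s ∈ S, f s = 0) → f w = 0}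

/-- The dimension of the Zariski closed set `V`: the Krull dimension of its coordinate ring. -/
noncomputable def varietyDim (V : Set W) : WithBot ℕ∞ :=
  ringKrullDim (coordinateRing V)

/-- The `m`-th secant variety of `V`: the Zariski closure of `{x₁ + ⋯ + xₘ | xᵢ ∈ V}`. -/
def secantVariety (m : ℕ) (V : Set W) : Set W :=
  zariskiClosure {w | ∃ x : Fin m → W, (∀ i, x i ∈ V) ∧ w = ∑ i, x i}

/-- `V` is `m`-nondefective: with `N = dim V`, its `m`-th secant variety has the expected
dimension `min {m N, dim W}`. -/
def IsNondefective (m : ℕ) (V : Set W) : Prop :=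
  ∃ N : ℕ, varietyDim V = N ∧
    varietyDim (secantVariety m V) = (min (m * N) (Module.finrank ℂ W) : ℕ)

/-- `g` is the generic rank with respect to `V`: the least number `g` such that the `g`-th
secant variety of `V` is the whole ambient space. -/
def IsGenericRank (V : Set W) (g : ℕ) : Prop :=
  IsLeast {k : ℕ | secantVariety k V = Set.univ} g

end Varieties

/-- `S^d(ℂⁿ)`: the space of forms of degree `d` in `n` variables. -/
abbrev Forms (d n : ℕ) : Submodule ℂ (MvPolynomial (Fin n) ℂ) :=
  homogeneousSubmodule (Fin n) ℂ d

/-- The quadratic form `∑ᵢⱼ Aᵢⱼ xᵢ xⱼ` of a square matrix `A`. -/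
noncomputable def quadraticFormOf {n : ℕ} (A : Matrix (Fin n) (Fin n) ℂ) :
    MvPolynomial (Fin n) ℂ :=
  ∑ i, ∑ j, C (A i j) * X i * X j

/-- The quadratic form `q` has rank at most `r`: the symmetric matrix representing `q`
(which is unique) has rank at most `r`. -/
def QuadRankLE {n : ℕ} (q : Forms 2 n) (r : ℕ) : Prop :=
  ∃ A : Matrix (Fin n) (Fin n) ℂ, A.IsSymm ∧ (q : MvPolynomial (Fin n) ℂ) = quadraticFormOf A ∧
    A.rank ≤ r

/-- `s_d(ℓ, q)`: the homogeneous part of degree `d` of `exp (ℓ + q / 2)`. As `ℓ + q / 2` has no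
constant term, only the terms `(ℓ + q / 2) ^ k / k!` with `k ≤ d` contribute to degree `d`. -/
noncomputable def gaussianMoment (d : ℕ) {n : ℕ} (l : Forms 1 n) (q : Forms 2 n) : Forms d n :=
  ⟨homogeneousComponent d (∑ k ∈ Finset.range (d + 1),
      ((k.factorial : ℂ)⁻¹) •
        ((l : MvPolynomial (Fin n) ℂ) + (2⁻¹ : ℂ) • (q : MvPolynomial (Fin n) ℂ)) ^ k),
    homogeneousComponent_mem _ _⟩

/-- `GM_{d,r}(ℂⁿ)`: the Zariski closure in `S^d(ℂⁿ)` of the set of all degree `d` moment forms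
`s_d(ℓ, q)` with `ℓ` a linear form and `q` a quadratic form of rank at most `r`. -/
def gaussianMomentVariety (d r n : ℕ) : Set (Forms d n) :=
  zariskiClosure {f | ∃ (l : Forms 1 n) (q : Forms 2 n), QuadRankLE q r ∧ f = gaussianMoment d l q}

/-- `M_r = (r + 1) n - (r choose 2)`. -/
noncomputable def parameterCount (r n : ℕ) : ℝ :=
  ((r : ℝ) + 1) * n - (r.choose 2 : ℝ)

end GaussianMoments

/-! A quadratic form of rank at most r over ℂ is a sum of r squares, so GM is the closure of the
image of the polynomial map (ℓ, k_1, …, k_r) ↦ s_d(ℓ, ∑ k_a²). Put N = dim GM, D = dim S^d and δ_m =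
dim σ_m GM. Dimensions of closures of images are generic ranks of Jacobians
(`ringKrullDim_adjoin_range`), so by Terracini's lemma δ_m is the dimension of the sum of the
tangent spaces at m generic points (`secantRank`).

The increments of δ never grow (`secantRank_concave`). The key point is
`secantRank_eq_card_of_stationary`: if two consecutive increments δ_{m+1} - δ_m and δ_{m+2} -
δ_{m+1} agree and are smaller than N, then already δ_m = D. Equal increments mean that a generic
tangent space meets the sum of m others in the same space as the sum of m + 1 others. Exchanging the
points one at a time, this nonzero intersection does not depend on the m points, so some nonzero
form lies in the sum of the tangent spaces at m generic points. The forms with this property make up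
a subspace stable under linear changes of coordinates, and S^d is irreducible.

Hence the increments, once below N, drop at every step until the space is filled. If δ_j = jN holds
exactly up to j = k, then D ≤ kN + (N-1)² and δ_{k+N-1} = D (`exists_linear_growth`).

The tangent space is s_{d-1} L + s_{d-2} K L, where L is the space of linear forms and K is spanned
by the k_a. The relations k_a k_b = k_b k_a give N ≤ M_r, which suffices for the first claim. The
second uses N = M_r, proved at one explicit point from the coprimality of s_{d-1} and s_{d-2}. This
leaves r ≥ 1 with n = 1, or d ≤ 2, or d = 3 and r = n; there n tangent spaces already fill S^d, and
n ≤ M_r. -/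

namespace GaussianMoments

open MvPolynomial

/-! ### Krull dimension and the Jacobian criterion -/

section KrullDimension

/-- Integral extensions preserve the Krull dimension. -/
theorem ringKrullDim_eq_of_isIntegral (R S : Type*) [CommRing R] [CommRing S] [Algebra R S]
    [FaithfulSMul R S] [Algebra.IsIntegral R S] : ringKrullDim S = ringKrullDim R := by
  apply le_antisymm
  · refine Order.krullDim_le_of_strictMono (PrimeSpectrum.comap (algebraMap R S)) ?_
    intro I J hIJ
    exact Ideal.IsIntegral.comap_lt_comap (R := R) (A := S) hIJ
  · refine iSup_le fun l => ?_
    obtain ⟨P, hP, hover⟩ := (Ideal.nonempty_primesOver (S := S) l.head.asIdeal).some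
    obtain ⟨L, hL, -⟩ := Ideal.exists_ltSeries_of_hasGoingUp (S := S) l P
    rw [← hL]
    exact Order.LTSeries.length_le_krullDim L

end KrullDimension

section Jacobian

variable {σ : Type*}

/-- The gradient of a polynomial, over the field of rational functions. -/
noncomputable def gradient (f : MvPolynomial σ ℂ) : σ → FractionRing (MvPolynomial σ ℂ) :=
  fun j => algebraMap _ _ (pderiv j f)

/-- The derivation kills the subalgebra generated by `s`, so a relation p(a) = 0 over it gives p'(a)
δ(a) = 0. If p'(a) = 0, then p' is a relation of smaller degree, nonzero in characteristic zero, and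
one descends. -/
theorem derivation_eq_zero_of_isAlgebraic {A K : Type*} [CommRing A] [IsDomain A] [Algebra ℂ A]
    [Field K] [Algebra A K] [Algebra ℂ K] [IsScalarTower ℂ A K] [FaithfulSMul A K]
    (δ : Derivation ℂ A K) (s : Set A)
    (hs : ∀ y ∈ s, δ y = 0) {a : A} (ha : IsAlgebraic (Algebra.adjoin ℂ s) a) : δ a = 0 := by
  have hB : ∀ b ∈ Algebra.adjoin ℂ s, δ b = 0 := by
    intro b hb
    have := Derivation.eqOn_adjoin (D1 := δ) (D2 := 0) (s := s) (fun y hy => by simp [hs y hy])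
    simpa using this hb
  let δB : Derivation (Algebra.adjoin ℂ s) A K :=
    { toFun := δ
      map_add' := map_add δ
      map_smul' := fun b x => by
        change δ ((b : A) * x) = (b : A) • δ x
        rw [δ.leibniz, hB b b.2, smul_zero, add_zero]
      map_one_eq_zero' := by
        change δ 1 = 0
        simp
      leibniz' := δ.leibniz }
  suffices H : ∀ (n : ℕ) (p : Polynomial (Algebra.adjoin ℂ s)), p.natDegree = n → p ≠ 0 →
      Polynomial.aeval a p = 0 → δ a = 0 by
    obtain ⟨p, hp0, hp⟩ := ha
    exact H _ p rfl hp0 hp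
  intro n
  induction n using Nat.strong_induction_on with
  | _ n ih =>
    intro p hn hp0 hp
    by_cases hd : p.natDegree = 0
    · exfalso
      rw [Polynomial.eq_C_of_natDegree_eq_zero hd, Polynomial.aeval_C] at hp
      apply hp0
      rw [Polynomial.eq_C_of_natDegree_eq_zero hd]
      have : p.coeff 0 = 0 := Subtype.ext hp
      rw [this, Polynomial.C_0]
    · have h1 := δB.map_aeval p a
      rw [hp, map_zero] at h1
      by_cases h2 : Polynomial.aeval a (Polynomial.derivative p) = 0
      · refine ih _ ?_ _ rfl ?_ h2
        · rw [← hn]; exact Polynomial.natDegree_derivative_lt hd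
        · intro h0
          have : CharZero (Algebra.adjoin ℂ s) :=
            charZero_of_injective_algebraMap (algebraMap ℂ _).injective
          exact hd (Polynomial.derivative_eq_zero.1 h0)
      · rw [eq_comm, ← algebraMap_smul K, smul_eq_mul, mul_eq_zero] at h1
        rcases h1 with h1 | h1
        · exact absurd ((FaithfulSMul.algebraMap_injective A K) (by rw [h1, map_zero])) h2
        · exact h1

/-- A linear functional of gradients is a derivation with values in the fraction field. One that
separated the gradient of `a` from those of `s` would kill `s` but not `a`, although `a` is
algebraic over `s`. -/
theorem gradient_mem_span [Fintype σ] (s : Set (MvPolynomial σ ℂ)) {a : MvPolynomial σ ℂ}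
    (ha : IsAlgebraic (Algebra.adjoin ℂ s) a) :
    gradient a ∈ Submodule.span (FractionRing (MvPolynomial σ ℂ)) (gradient '' s) := by
  classical
  by_contra hcon
  obtain ⟨f, hfa, hf⟩ := Submodule.exists_le_ker_of_notMem hcon
  let δ : Derivation ℂ (MvPolynomial σ ℂ) (FractionRing (MvPolynomial σ ℂ)) :=
    mkDerivation ℂ fun j => f (Pi.single j 1)
  have hδ : ∀ p, δ p = f (gradient p) := by
    intro p
    have hfs : ∀ p, f (gradient p) = ∑ j, algebraMap (MvPolynomial σ ℂ)
        (FractionRing (MvPolynomial σ ℂ)) (pderiv j p) * f (Pi.single j 1) := by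
      intro p
      conv_lhs => rw [LinearMap.pi_apply_eq_sum_univ f (gradient p)]
      refine Finset.sum_congr rfl fun j _ => ?_
      rw [smul_eq_mul]
      congr 2
      ext i
      simp [Pi.single_apply, eq_comm]
    rw [hfs]
    induction p using MvPolynomial.induction_on with
    | C c => simp [δ]
    | add p q hp hq => simp [hp, hq, add_mul, Finset.sum_add_distrib]
    | mul_X p i hp =>
      rw [δ.leibniz, hp]
      simp only [δ, mkDerivation_X, Derivation.leibniz, pderiv_X, smul_eq_mul, map_add, map_mul,
        add_mul, Finset.sum_add_distrib, Algebra.smul_def]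
      congr 1
      · rw [Finset.sum_eq_single i]
        · simp
        · intro j _ hj
          simp [Ne.symm hj]
        · simp
      · rw [Finset.mul_sum]
        refine Finset.sum_congr rfl fun j _ => by ring
  apply hfa
  rw [← hδ]
  refine derivation_eq_zero_of_isAlgebraic δ s (fun y hy => ?_) ha
  rw [hδ]
  exact hf (Submodule.subset_span ⟨y, hy, rfl⟩)

/-- Enlarge `y` by variables to a transcendence basis. It has as many elements as there are
variables, and its gradients span because every variable is algebraic over it; a spanning family of
the right size is independent. -/
theorem linearIndependent_gradient [Fintype σ] {κ : Type*} {y : κ → MvPolynomial σ ℂ}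
    (hy : AlgebraicIndependent ℂ y) :
    LinearIndependent (FractionRing (MvPolynomial σ ℂ)) fun i => gradient (y i) := by
  classical
  have halg : Algebra.IsAlgebraic
      (Algebra.adjoin ℂ (Set.range y ∪ Set.range (X : σ → MvPolynomial σ ℂ)))
      (MvPolynomial σ ℂ) := by
    constructor
    intro a
    have : a ∈ Algebra.adjoin ℂ (Set.range y ∪ Set.range (X : σ → MvPolynomial σ ℂ)) := by
      have h : a ∈ (⊤ : Subalgebra ℂ (MvPolynomial σ ℂ)) := trivial
      rw [← adjoin_range_X] at h
      exact Algebra.adjoin_mono Set.subset_union_right h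
    exact isAlgebraic_algebraMap
      (⟨a, this⟩ : Algebra.adjoin ℂ (Set.range y ∪ Set.range (X : σ → MvPolynomial σ ℂ)))
  obtain ⟨u, hyu, -, hu⟩ := exists_isTranscendenceBasis_between (R := ℂ) (Set.range y)
    (Set.range y ∪ Set.range (X : σ → MvPolynomial σ ℂ)) Set.subset_union_left hy.to_subtype_range
  have hcard := hu.lift_cardinalMk_eq (IsTranscendenceBasis.mvPolynomial σ ℂ)
  have hfin : Finite u := by
    rw [← Cardinal.lt_aleph0_iff_finite, ← Cardinal.lift_lt_aleph0, hcard]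
    simp
  have := Fintype.ofFinite u
  have hcard' : Fintype.card u = Fintype.card σ := by
    simp only [Cardinal.mk_fintype, Cardinal.lift_natCast] at hcard
    exact_mod_cast hcard
  have hspan : ⊤ ≤ Submodule.span (FractionRing (MvPolynomial σ ℂ))
      (Set.range fun i : u => gradient (i : MvPolynomial σ ℂ)) := by
    rw [← (Pi.basisFun (FractionRing (MvPolynomial σ ℂ)) σ).span_eq, Submodule.span_le]
    rintro _ ⟨j, rfl⟩
    have h1 : IsAlgebraic (Algebra.adjoin ℂ u) (X j : MvPolynomial σ ℂ) := by
      have := hu.isAlgebraic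
      rw [Subtype.range_coe] at this
      exact this.1 _
    have h2 := gradient_mem_span u h1
    have h3 : gradient (X j : MvPolynomial σ ℂ)
        = Pi.basisFun (FractionRing (MvPolynomial σ ℂ)) σ j := by
      ext i
      simp only [gradient, pderiv_X, Pi.basisFun_apply, Pi.single_apply]
      rw [apply_ite (algebraMap _ _), map_one, map_zero]
      simp only [eq_comm]
    rw [h3] at h2
    have h4 : (Set.range fun i : u => gradient (i : MvPolynomial σ ℂ)) = gradient '' u := by
      ext; simp
    rw [h4]
    exact h2
  have hli := linearIndependent_of_top_le_span_of_card_eq_finrank hspan (by simp [hcard'])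
  let e : κ → u := fun i => ⟨y i, hyu ⟨i, rfl⟩⟩
  have he : Function.Injective e := fun i j hij => hy.injective (congrArg Subtype.val hij)
  have hcomp := hli.comp e he
  have heq : (fun i => gradient (y i)) =
      (fun i : u => gradient (i : MvPolynomial σ ℂ)) ∘ e := rfl
  rw [heq]
  exact hcomp

/-- The Jacobian criterion: the Krull dimension of an algebra generated by finitely many
polynomials is the rank of their gradients. -/
theorem ringKrullDim_adjoin_range [Fintype σ] {β : Type*} [Finite β] (Φ : β → MvPolynomial σ ℂ) :
    ringKrullDim (Algebra.adjoin ℂ (Set.range Φ)) =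
      (Module.finrank (FractionRing (MvPolynomial σ ℂ))
        (Submodule.span (FractionRing (MvPolynomial σ ℂ))
          (Set.range fun b => gradient (Φ b))) : ℕ) := by
  classical
  have hft : Algebra.FiniteType ℂ (Algebra.adjoin ℂ (Set.range Φ)) :=
    (Subalgebra.fg_iff_finiteType _).1 (⟨(Set.finite_range Φ).toFinset, by simp⟩) 
  -- Noether normalization: the algebra is integral over a polynomial ring in `s` variables. The
  -- images `y` of these variables are algebraically independent, and `y` and `Φ` are algebraic over
  -- each other, so their gradients span the same space.
  obtain ⟨s, g, hginj, hgint⟩ :=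
    exists_integral_inj_algHom_of_fg ℂ (Algebra.adjoin ℂ (Set.range Φ))
  have hdim : ringKrullDim (Algebra.adjoin ℂ (Set.range Φ)) = s := by
    let _ := g.toRingHom.toAlgebra
    have : FaithfulSMul (MvPolynomial (Fin s) ℂ) (Algebra.adjoin ℂ (Set.range Φ)) :=
      (faithfulSMul_iff_algebraMap_injective _ _).2 hginj
    have : Algebra.IsIntegral (MvPolynomial (Fin s) ℂ) (Algebra.adjoin ℂ (Set.range Φ)) :=
      ⟨hgint⟩
    rw [ringKrullDim_eq_of_isIntegral (MvPolynomial (Fin s) ℂ),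
      MvPolynomial.ringKrullDim_of_isNoetherianRing, ringKrullDim_eq_zero_of_field]
    simp
  rw [hdim]
  let y : Fin s → MvPolynomial σ ℂ := fun i => (g (X i) : MvPolynomial σ ℂ)
  have hyg : ∀ p, aeval y p = (g p : MvPolynomial σ ℂ) := by
    intro p
    have : aeval y = (Subalgebra.val _).comp g := by
      ext i
      simp [y]
    rw [this]
    rfl
  have hyind : AlgebraicIndependent ℂ y := by
    rw [algebraicIndependent_iff_injective_aeval]
    intro p q hpq
    rw [hyg, hyg] at hpq
    exact hginj (Subtype.ext hpq)
  have hli := linearIndependent_gradient hyind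
  have hspan : Submodule.span (FractionRing (MvPolynomial σ ℂ))
      (Set.range fun b => gradient (Φ b)) =
      Submodule.span (FractionRing (MvPolynomial σ ℂ)) (Set.range fun i => gradient (y i)) := by
    apply le_antisymm
    · rw [Submodule.span_le]
      rintro _ ⟨b, rfl⟩
      have halg : IsAlgebraic (Algebra.adjoin ℂ (Set.range y)) (Φ b) := by
        obtain ⟨p, hpm, hp⟩ := hgint ⟨Φ b, Algebra.subset_adjoin ⟨b, rfl⟩⟩
        have hmem : ∀ q, (g q : MvPolynomial σ ℂ) ∈ Algebra.adjoin ℂ (Set.range y) := by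
          intro q
          rw [← hyg, Algebra.adjoin_range_eq_range_aeval]
          exact ⟨q, rfl⟩
        let g' : MvPolynomial (Fin s) ℂ →+* Algebra.adjoin ℂ (Set.range y) :=
          ((Subalgebra.val _).toRingHom.comp g.toRingHom).codRestrict
            (Algebra.adjoin ℂ (Set.range y)) hmem
        refine ⟨p.map g', (hpm.map g').ne_zero, ?_⟩
        rw [Polynomial.aeval_def, Polynomial.eval₂_map]
        have := congrArg (Subalgebra.val _).toRingHom hp
        rw [Polynomial.hom_eval₂, map_zero] at this
        exact this
      have := gradient_mem_span _ halg
      rwa [← Set.range_comp] at this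
    · rw [Submodule.span_le]
      rintro _ ⟨i, rfl⟩
      have halg : IsAlgebraic (Algebra.adjoin ℂ (Set.range Φ)) (y i) :=
        isAlgebraic_algebraMap (g (X i))
      have := gradient_mem_span _ halg
      rwa [← Set.range_comp] at this
  rw [hspan, finrank_span_eq_card hli, Fintype.card_fin]

end Jacobian

end GaussianMoments
namespace GaussianMoments

open MvPolynomial

/-! ### Properties of generic points -/

section Generic

variable {σ : Type*}

variable (σ) in
/-- The filter of sets that contain the nonvanishing locus of some nonzero polynomial. -/
def zariskiGeneric : Filter (σ → ℂ) where
  sets := {s | ∃ g : MvPolynomial σ ℂ, g ≠ 0 ∧ ∀ x, eval x g ≠ 0 → x ∈ s}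
  univ_sets := ⟨1, one_ne_zero, fun _ _ => trivial⟩
  sets_of_superset := by
    rintro s t ⟨g, hg, h⟩ hst
    exact ⟨g, hg, fun x hx => hst (h x hx)⟩
  inter_sets := by
    rintro s t ⟨g, hg, h⟩ ⟨g', hg', h'⟩
    refine ⟨g * g', mul_ne_zero hg hg', fun x hx => ?_⟩
    rw [map_mul] at hx
    exact ⟨h x (left_ne_zero_of_mul hx), h' x (right_ne_zero_of_mul hx)⟩

theorem eventually_zariskiGeneric {P : (σ → ℂ) → Prop} :
    (∀ᶠ x in zariskiGeneric σ, P x) ↔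
      ∃ g : MvPolynomial σ ℂ, g ≠ 0 ∧ ∀ x, eval x g ≠ 0 → P x := Iff.rfl

theorem exists_eval_ne_zero {g : MvPolynomial σ ℂ} (hg : g ≠ 0) : ∃ x, eval x g ≠ 0 := by
  by_contra! h
  exact hg (MvPolynomial.funext fun x => by rw [h x, map_zero])

instance : (zariskiGeneric σ).NeBot := by
  refine ⟨fun h => ?_⟩
  have : ∀ᶠ _ in zariskiGeneric σ, False := by rw [h]; trivial
  obtain ⟨g, hg, h⟩ := eventually_zariskiGeneric.1 this
  obtain ⟨x, hx⟩ := exists_eval_ne_zero hg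
  exact h x hx

/-- Generic properties pull back along surjective polynomial maps. -/
theorem eventually_comp {τ : Type*} (Γ : τ → MvPolynomial σ ℂ)
    (hΓ : Function.Surjective fun (x : σ → ℂ) i => eval x (Γ i)) {P : (τ → ℂ) → Prop}
    (hP : ∀ᶠ x in zariskiGeneric τ, P x) :
    ∀ᶠ x in zariskiGeneric σ, P fun i => eval x (Γ i) := by
  obtain ⟨g, hg, h⟩ := eventually_zariskiGeneric.1 hP
  have key : ∀ x, eval x (aeval Γ g) = eval (fun i => eval x (Γ i)) g := by
    intro x
    rw [← coe_aeval_eq_eval, ← coe_aeval_eq_eval]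
    change aeval x (aeval Γ g) = aeval _ g
    rw [← AlgHom.comp_apply, comp_aeval]
    rfl
  refine eventually_zariskiGeneric.2 ⟨aeval Γ g, ?_, fun x hx => h _ (by rwa [key] at hx)⟩
  intro h0
  obtain ⟨y, hy⟩ := exists_eval_ne_zero hg
  obtain ⟨x, rfl⟩ := hΓ y
  apply hy
  rw [← key, h0, map_zero]

/-- For a generic point, a generic property still holds generically when some of the coordinates
of the point are kept and the others are replaced by arbitrary ones. -/
theorem eventually_eventually_piecewise (s : Set σ) [DecidablePred (· ∈ s)]
    {P : (σ → ℂ) → Prop} (hP : ∀ᶠ x in zariskiGeneric σ, P x) :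
    ∀ᶠ x in zariskiGeneric σ, ∀ᶠ y in zariskiGeneric σ, P (s.piecewise x y) := by
  obtain ⟨g, hg, h⟩ := eventually_zariskiGeneric.1 hP
  -- For fixed `x` with g(x) ≠ 0, the polynomial in `y` obtained by freezing the coordinates in `s`
  -- is nonzero, since its value at `y = x` is g(x).
  refine eventually_zariskiGeneric.2 ⟨g, hg, fun x hx => ?_⟩
  let Γ : σ → MvPolynomial σ ℂ := s.piecewise (fun i => C (x i)) X
  have key : ∀ y, eval y (aeval Γ g) = eval (s.piecewise x y) g := by
    intro y
    rw [← coe_aeval_eq_eval, ← coe_aeval_eq_eval]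
    change aeval y (aeval Γ g) = aeval _ g
    rw [← AlgHom.comp_apply, comp_aeval]
    congr 2
    funext i
    by_cases hi : i ∈ s <;> simp [Γ, hi]
  refine eventually_zariskiGeneric.2 ⟨aeval Γ g, ?_, fun y hy => h _ (by rwa [key] at hy)⟩
  intro h0
  apply hx
  have := key x
  rw [h0, map_zero] at this
  rw [this]
  congr 2
  exact (Set.piecewise_same (s := s) (f := x)).symm

end Generic

/-! ### Generic rank and semicontinuity -/

section Rank

/-- A certificate for the rank that survives variation of `M`: with `A` and `B` held fixed, the
determinant of `A * M * B` is a polynomial in the entries of `M`, and its nonvanishing bounds the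
rank from below. -/
theorem exists_mul_mul_eq_one {F m n : Type*} [Field F] [Fintype m] [Fintype n] [DecidableEq m]
    [DecidableEq n] (M : Matrix m n F) {k : ℕ} (hk : M.rank = k) :
    ∃ (A : Matrix (Fin k) m F) (B : Matrix n (Fin k) F), A * M * B = 1 := by
  let b : Module.Basis (Fin k) F (LinearMap.range M.mulVecLin) :=
    Module.finBasisOfFinrankEq F (LinearMap.range M.mulVecLin) hk
  choose v hv using fun i => (b i).2
  let f : (Fin k → F) →ₗ[F] (m → F) :=
    (LinearMap.range M.mulVecLin).subtype ∘ₗ b.equivFun.symm.toLinearMap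
  have hf : LinearMap.ker f = ⊥ := by
    rw [LinearMap.ker_eq_bot]
    exact Subtype.val_injective.comp b.equivFun.symm.injective
  obtain ⟨g, hg⟩ := f.exists_leftInverse_of_injective hf
  refine ⟨LinearMap.toMatrix' g, Matrix.of fun j i => v i j, ?_⟩
  have h1 : M * (Matrix.of fun j i => v i j) = LinearMap.toMatrix' f := by
    ext i j
    rw [LinearMap.toMatrix'_apply]
    have h2 : f (Pi.single j 1) = (b j : m → F) := by
      simp [f]
    rw [h2, ← hv]
    rfl
  rw [Matrix.mul_assoc, h1, ← LinearMap.toMatrix'_comp, hg, LinearMap.toMatrix'_id]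

theorem le_rank_of_det_ne_zero {F m n : Type*} [Field F] [Fintype m] [Fintype n] {k : ℕ}
    (M : Matrix m n F) (A : Matrix (Fin k) m F) (B : Matrix n (Fin k) F)
    (h : (A * M * B).det ≠ 0) : k ≤ M.rank := by
  have h1 := Matrix.rank_of_det_ne_zero h
  rw [Fintype.card_fin] at h1
  calc k = (A * M * B).rank := h1.symm
    _ ≤ (A * M).rank := Matrix.rank_mul_le_left _ _
    _ ≤ M.rank := Matrix.rank_mul_le_right _ _

variable {σ β γ : Type*} [Fintype β] [Fintype γ]

theorem rank_eval_le_rank_fractionRing (J : Matrix β γ (MvPolynomial σ ℂ)) (x : σ → ℂ) :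
    (J.map (eval x)).rank ≤
      (J.map (algebraMap _ (FractionRing (MvPolynomial σ ℂ)))).rank := by
  classical
  obtain ⟨A, B, h⟩ := exists_mul_mul_eq_one (J.map (eval x)) rfl
  refine le_rank_of_det_ne_zero _ ((A.map (C (σ := σ))).map (algebraMap _ _))
    ((B.map (C (σ := σ))).map (algebraMap _ _)) ?_
  rw [← Matrix.map_mul, ← Matrix.map_mul, ← RingHom.mapMatrix_apply, ← RingHom.map_det]
  intro h0
  have h1 := IsFractionRing.injective (MvPolynomial σ ℂ) (FractionRing (MvPolynomial σ ℂ))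
    (h0.trans (map_zero _).symm)
  have h2 := congrArg (eval x) h1
  rw [RingHom.map_det, RingHom.mapMatrix_apply, Matrix.map_mul, Matrix.map_mul, map_zero,
    Matrix.map_map, Matrix.map_map] at h2
  have h3 : (eval x : MvPolynomial σ ℂ → ℂ) ∘ C = id := by ext; simp
  rw [h3, Matrix.map_id, Matrix.map_id, h, Matrix.det_one] at h2
  exact one_ne_zero h2

/-- The rank of a matrix of polynomials is lower semicontinuous. -/
theorem eventually_rank_le_rank_eval (J : Matrix β γ (MvPolynomial σ ℂ)) (x : σ → ℂ) :
    ∀ᶠ y in zariskiGeneric σ, (J.map (eval x)).rank ≤ (J.map (eval y)).rank := by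
  classical
  obtain ⟨A, B, h⟩ := exists_mul_mul_eq_one (J.map (eval x)) rfl
  have key : ∀ y, eval y (A.map (C (σ := σ)) * J * B.map (C (σ := σ))).det = (A * J.map (eval y) * B).det := by
    intro y
    rw [RingHom.map_det, RingHom.mapMatrix_apply, Matrix.map_mul, Matrix.map_mul,
      Matrix.map_map, Matrix.map_map]
    have h3 : (eval y : MvPolynomial σ ℂ → ℂ) ∘ C = id := by ext; simp
    rw [h3, Matrix.map_id, Matrix.map_id]
  refine eventually_zariskiGeneric.2 ⟨(A.map (C (σ := σ)) * J * B.map (C (σ := σ))).det, ?_, fun y hy => ?_⟩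
  · intro h0
    have := key x
    rw [h0, map_zero, h, Matrix.det_one] at this
    exact zero_ne_one this
  · rw [key] at hy
    exact le_rank_of_det_ne_zero _ A B hy

theorem exists_rank_fractionRing_le_rank_eval (J : Matrix β γ (MvPolynomial σ ℂ)) :
    ∃ x : σ → ℂ, (J.map (algebraMap _ (FractionRing (MvPolynomial σ ℂ)))).rank ≤
      (J.map (eval x)).rank := by
  classical
  set K := FractionRing (MvPolynomial σ ℂ)
  obtain ⟨A, B, h⟩ := exists_mul_mul_eq_one (J.map (algebraMap _ K)) rfl
  -- Clearing denominators in the certificate makes its determinant a nonzero polynomial, and any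
  -- point where this does not vanish will do.
  obtain ⟨a, ha⟩ := IsLocalization.exist_integer_multiples_of_finite
    (nonZeroDivisors (MvPolynomial σ ℂ)) (fun p : Fin _ × β => A p.1 p.2)
  obtain ⟨b, hb⟩ := IsLocalization.exist_integer_multiples_of_finite
    (nonZeroDivisors (MvPolynomial σ ℂ)) (fun p : γ × Fin _ => B p.1 p.2)
  choose A' hA' using ha
  choose B' hB' using hb
  let A₁ : Matrix (Fin _) β (MvPolynomial σ ℂ) := Matrix.of fun i j => A' (i, j)
  let B₁ : Matrix γ (Fin _) (MvPolynomial σ ℂ) := Matrix.of fun i j => B' (i, j)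
  have hA : A₁.map (algebraMap _ K) = algebraMap _ K (a : MvPolynomial σ ℂ) • A := by
    ext i j
    rw [Matrix.smul_apply, smul_eq_mul, ← Algebra.smul_def]
    exact hA' (i, j)
  have hB : B₁.map (algebraMap _ K) = algebraMap _ K (b : MvPolynomial σ ℂ) • B := by
    ext i j
    rw [Matrix.smul_apply, smul_eq_mul, ← Algebra.smul_def]
    exact hB' (i, j)
  have hdet : (A₁ * J * B₁).det ≠ 0 := by
    intro h0
    have h1 := congrArg (algebraMap _ K) h0
    rw [RingHom.map_det, RingHom.mapMatrix_apply, Matrix.map_mul, Matrix.map_mul, map_zero, hA, hB,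
      Matrix.smul_mul, Matrix.smul_mul, Matrix.mul_smul, h, Matrix.det_smul, Matrix.det_smul,
      Matrix.det_one, mul_one] at h1
    have ha0 : algebraMap _ K (a : MvPolynomial σ ℂ) ≠ 0 :=
      IsFractionRing.to_map_ne_zero_of_mem_nonZeroDivisors a.2
    have hb0 : algebraMap _ K (b : MvPolynomial σ ℂ) ≠ 0 :=
      IsFractionRing.to_map_ne_zero_of_mem_nonZeroDivisors b.2
    exact mul_ne_zero (pow_ne_zero _ ha0) (pow_ne_zero _ hb0) h1
  obtain ⟨x, hx⟩ := exists_eval_ne_zero hdet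
  refine ⟨x, le_rank_of_det_ne_zero _ (A₁.map (eval x)) (B₁.map (eval x)) ?_⟩
  rwa [RingHom.map_det, RingHom.mapMatrix_apply, Matrix.map_mul, Matrix.map_mul] at hx

end Rank

end GaussianMoments
namespace GaussianMoments

open MvPolynomial

/-! ### Zariski closures and sums -/

section ZariskiClosure

variable {W : Type*} [AddCommGroup W] [Module ℂ W]

theorem subset_zariskiClosure (S : Set W) : S ⊆ zariskiClosure S := fun _ hs _ _ h => h _ hs

theorem zariskiClosure_subset_of_subset {S T : Set W} (h : S ⊆ zariskiClosure T) :
    zariskiClosure S ⊆ zariskiClosure T :=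
  fun _ hw f hf hT => hw f hf fun _ hs => h hs f hf hT

theorem polynomialFunctions_comp_add_const {f : W → ℂ} (hf : f ∈ polynomialFunctions W) (c : W) :
    (fun w => f (w + c)) ∈ polynomialFunctions W := by
  induction hf using Algebra.adjoin_induction with
  | mem f hf =>
    obtain ⟨φ, rfl⟩ := hf
    have : (fun w => φ (w + c)) = (fun w => φ w) + algebraMap ℂ (W → ℂ) (φ c) := by
      ext w
      simp
    change (fun w => φ (w + c)) ∈ _
    rw [this]
    exact add_mem (Algebra.subset_adjoin ⟨φ, rfl⟩) (Subalgebra.algebraMap_mem _ _)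
  | algebraMap r => exact Subalgebra.algebraMap_mem (polynomialFunctions W) r
  | add f g _ _ hf hg => exact add_mem hf hg
  | mul f g _ _ hf hg => exact mul_mem hf hg

/-- One summand is moved at a time: for t in T, the translate f(· + t) vanishes on S, hence at x;
then f(x + ·) vanishes on T, hence at y. -/
theorem add_mem_zariskiClosure {S T : Set W} {x y : W} (hx : x ∈ zariskiClosure S)
    (hy : y ∈ zariskiClosure T) : x + y ∈ zariskiClosure {w | ∃ s ∈ S, ∃ t ∈ T, w = s + t} := by
  intro f hf h
  have h1 : ∀ t ∈ T, f (t + x) = 0 := by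
    intro t ht
    rw [add_comm]
    exact hx _ (polynomialFunctions_comp_add_const hf t) fun s hs => h _ ⟨s, hs, t, ht, rfl⟩
  rw [add_comm]
  exact hy _ (polynomialFunctions_comp_add_const hf x) h1

theorem sum_mem_zariskiClosure {S : Set W} (m : ℕ) (x : Fin m → W)
    (hx : ∀ i, x i ∈ zariskiClosure S) :
    ∑ i, x i ∈ zariskiClosure {w | ∃ x : Fin m → W, (∀ i, x i ∈ S) ∧ w = ∑ i, x i} := by
  induction m with
  | zero => exact subset_zariskiClosure _ ⟨x, fun i => i.elim0, rfl⟩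
  | succ m ih =>
    rw [Fin.sum_univ_succ]
    have h := add_mem_zariskiClosure (hx 0) (ih (fun i => x i.succ) fun i => hx _)
    refine zariskiClosure_subset_of_subset ?_ h
    rintro _ ⟨s, hs, _, ⟨y, hy, rfl⟩, rfl⟩
    refine subset_zariskiClosure _ ⟨Fin.cons s y, fun i => ?_, ?_⟩
    · refine Fin.cases ?_ ?_ i
      · simpa using hs
      · simpa using hy
    · rw [Fin.sum_univ_succ]
      simp

theorem secantVariety_zariskiClosure (m : ℕ) (S : Set W) :
    secantVariety m (zariskiClosure S) =
      zariskiClosure {w | ∃ x : Fin m → W, (∀ i, x i ∈ S) ∧ w = ∑ i, x i} := by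
  apply subset_antisymm
  · apply zariskiClosure_subset_of_subset
    rintro _ ⟨x, hx, rfl⟩
    exact sum_mem_zariskiClosure m x hx
  · apply zariskiClosure_subset_of_subset
    rintro _ ⟨x, hx, rfl⟩
    exact subset_zariskiClosure _ ⟨x, fun i => subset_zariskiClosure _ (hx i), rfl⟩

/-- Restriction of functions from `W` to a subset. -/
def restrictAlgHom (S : Set W) : (W → ℂ) →ₐ[ℂ] (S → ℂ) where
  toFun f s := f s
  map_one' := rfl
  map_mul' _ _ := rfl
  map_zero' := rfl
  map_add' _ _ := rfl
  commutes' _ := rfl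

theorem coordinateRing_eq_map (S : Set W) :
    coordinateRing S = (polynomialFunctions W).map (restrictAlgHom S) := by
  rw [polynomialFunctions, AlgHom.map_adjoin, ← Set.range_comp]
  rfl

end ZariskiClosure

/-! ### Images of polynomial maps -/

section PolynomialMap

variable {W : Type*} [AddCommGroup W] [Module ℂ W] {β : Type*} [Fintype β]
  (e : Module.Basis β ℂ W) {σ : Type*} (Φ : β → MvPolynomial σ ℂ)

/-- The polynomial map with the given coordinates in the basis `e`. -/
noncomputable def polyMap (x : σ → ℂ) : W := e.equivFun.symm fun b => eval x (Φ b)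

variable (σ) in
/-- Polynomials as functions. -/
noncomputable def evalAlgHom : MvPolynomial σ ℂ →ₐ[ℂ] ((σ → ℂ) → ℂ) where
  toFun p x := eval x p
  map_one' := by ext; simp
  map_mul' _ _ := by ext; simp
  map_zero' := by ext; simp
  map_add' _ _ := by ext; simp
  commutes' _ := by ext; simp

theorem evalAlgHom_injective : Function.Injective (evalAlgHom σ) :=
  fun _ _ h => MvPolynomial.funext fun x => congrFun h x

/-- Pullback of functions along a polynomial map. -/
noncomputable def pullbackAlgHom : (W → ℂ) →ₐ[ℂ] ((σ → ℂ) → ℂ) where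
  toFun f x := f (polyMap e Φ x)
  map_one' := rfl
  map_mul' _ _ := rfl
  map_zero' := rfl
  map_add' _ _ := rfl
  commutes' _ := rfl

theorem map_pullbackAlgHom_polynomialFunctions :
    (polynomialFunctions W).map (pullbackAlgHom e Φ) =
      (Algebra.adjoin ℂ (Set.range Φ)).map (evalAlgHom σ) := by
  rw [polynomialFunctions, AlgHom.map_adjoin, AlgHom.map_adjoin]
  apply le_antisymm
  · refine Algebra.adjoin_le ?_
    rintro _ ⟨_, ⟨φ, rfl⟩, rfl⟩
    have : (pullbackAlgHom e Φ fun w => φ w) = ∑ b, φ (e b) • evalAlgHom σ (Φ b) := by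
      ext x
      simp only [pullbackAlgHom, evalAlgHom, AlgHom.coe_mk, RingHom.coe_mk, MonoidHom.coe_mk,
        OneHom.coe_mk, polyMap, Module.Basis.equivFun_symm_apply, map_sum, map_smul,
        Finset.sum_apply, Pi.smul_apply, smul_eq_mul]
      exact Finset.sum_congr rfl fun b _ => mul_comm _ _
    change (pullbackAlgHom e Φ fun w => φ w) ∈ _
    rw [this]
    exact sum_mem fun b _ => Subalgebra.smul_mem _
      (Algebra.subset_adjoin (Set.mem_image_of_mem _ (Set.mem_range_self b))) _
  · refine Algebra.adjoin_le ?_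
    rintro _ ⟨_, ⟨b, rfl⟩, rfl⟩
    refine Algebra.subset_adjoin ⟨fun w => e.coord b w, ⟨e.coord b, rfl⟩, ?_⟩
    ext x
    change e.equivFun (e.equivFun.symm fun b => eval x (Φ b)) b = _
    rw [LinearEquiv.apply_symm_apply]
    rfl

/-- Pullback identifies the coordinate ring of the closure with the algebra generated by the
coordinates `Φ`: a polynomial function that vanishes on the image vanishes on its closure. -/
theorem varietyDim_zariskiClosure_range :
    varietyDim (zariskiClosure (Set.range (polyMap e Φ))) =
      ringKrullDim (Algebra.adjoin ℂ (Set.range Φ)) := by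
  set V := zariskiClosure (Set.range (polyMap e Φ))
  have hV : ∀ x, polyMap e Φ x ∈ V := fun x => subset_zariskiClosure _ ⟨x, rfl⟩
  let pull : (V → ℂ) →ₐ[ℂ] ((σ → ℂ) → ℂ) :=
    { toFun := fun f x => f ⟨polyMap e Φ x, hV x⟩
      map_one' := rfl
      map_mul' := fun _ _ => rfl
      map_zero' := rfl
      map_add' := fun _ _ => rfl
      commutes' := fun _ => rfl }
  have hcomp : pull.comp (restrictAlgHom V) = pullbackAlgHom e Φ := rfl
  have hmap : (coordinateRing V).map pull =
      (Algebra.adjoin ℂ (Set.range Φ)).map (evalAlgHom σ) := by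
    rw [coordinateRing_eq_map, Subalgebra.map_map, hcomp, map_pullbackAlgHom_polynomialFunctions]
  have hmem : ∀ f : coordinateRing V,
      (pull.comp (coordinateRing V).val) f ∈
        (Algebra.adjoin ℂ (Set.range Φ)).map (evalAlgHom σ) := by
    intro f
    rw [← hmap]
    exact ⟨f, f.2, rfl⟩
  let θ := (pull.comp (coordinateRing V).val).codRestrict _ hmem
  have hθ : Function.Bijective θ := by
    constructor
    · rw [injective_iff_map_eq_zero]
      rintro ⟨f, hf⟩ h
      have h' : pull f = 0 := congrArg Subtype.val h
      apply Subtype.ext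
      have hf' := hf
      rw [coordinateRing_eq_map] at hf'
      obtain ⟨g, hg, rfl⟩ := hf'
      ext ⟨w, hw⟩
      refine hw g hg ?_
      rintro _ ⟨x, rfl⟩
      exact congrFun h' x
    · rintro ⟨f, hf⟩
      have hf' := hf
      rw [← hmap] at hf'
      obtain ⟨g, hg, rfl⟩ := hf'
      exact ⟨⟨g, hg⟩, rfl⟩
  rw [varietyDim, ringKrullDim_eq_of_ringEquiv (AlgEquiv.ofBijective θ hθ).toRingEquiv,
    ← ringKrullDim_eq_of_ringEquiv
      ((Algebra.adjoin ℂ (Set.range Φ)).equivMapOfInjective _ evalAlgHom_injective).toRingEquiv]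

/-- The Jacobian matrix. -/
noncomputable def jacobian : Matrix β σ (MvPolynomial σ ℂ) :=
  Matrix.of fun b j => pderiv j (Φ b)

theorem varietyDim_eq_rank_jacobian [Fintype σ] :
    varietyDim (zariskiClosure (Set.range (polyMap e Φ))) =
      (((jacobian Φ).map (algebraMap _ (FractionRing (MvPolynomial σ ℂ)))).rank : ℕ) := by
  rw [varietyDim_zariskiClosure_range, ringKrullDim_adjoin_range, Matrix.rank_eq_finrank_span_row]
  rfl

/-- If the Jacobian has full rank, then the polynomial map is dominant. -/
theorem zariskiClosure_range_eq_univ [Fintype σ]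
    (h : ((jacobian Φ).map (algebraMap _ (FractionRing (MvPolynomial σ ℂ)))).rank =
      Fintype.card β) :
    zariskiClosure (Set.range (polyMap e Φ)) = Set.univ := by
  have hdim : ringKrullDim (Algebra.adjoin ℂ (Set.range Φ)) = Fintype.card β := by
    rw [← varietyDim_zariskiClosure_range e, varietyDim_eq_rank_jacobian, h]
  -- A nonzero relation p would make the algebra generated by `Φ` a quotient of ℂ[β]/(p), whose
  -- dimension is smaller than the number of coordinates.
  have hinj : ∀ p : MvPolynomial β ℂ, aeval Φ p = 0 → p = 0 := by
    intro p hp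
    by_contra hp0
    have h1 := ringKrullDim_quotient_succ_le_of_nonZeroDivisor (r := p)
      (mem_nonZeroDivisors_of_ne_zero hp0)
    rw [MvPolynomial.ringKrullDim_of_isNoetherianRing, ringKrullDim_eq_zero_of_field, zero_add,
      Nat.card_eq_fintype_card] at h1
    have hle : Ideal.span {p} ≤ RingHom.ker (aeval (R := ℂ) Φ).rangeRestrict := by
      rw [Ideal.span_singleton_le_iff_mem, RingHom.mem_ker]
      exact Subtype.ext hp
    have h2 := ringKrullDim_le_of_surjective
      (Ideal.Quotient.lift (Ideal.span {p}) (aeval (R := ℂ) Φ).rangeRestrict.toRingHom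
        fun a ha => hle ha)
      (Ideal.Quotient.lift_surjective_of_surjective _ _ (aeval Φ).rangeRestrict_surjective)
    rw [← Algebra.adjoin_range_eq_range_aeval, hdim] at h2
    have h3 := (add_le_add_left h2 1).trans h1
    have h4 : ((Fintype.card β + 1 : ℕ) : WithBot ℕ∞) ≤ (Fintype.card β : ℕ) := by
      push_cast
      exact h3
    have h5 : Fintype.card β + 1 ≤ Fintype.card β := by exact_mod_cast h4
    omega
  have hpoly : ∀ f ∈ polynomialFunctions W, ∃ p : MvPolynomial β ℂ,
      ∀ w, f w = eval (e.equivFun w) p := by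
    intro f hf
    induction hf using Algebra.adjoin_induction with
    | mem f hf =>
      obtain ⟨φ, rfl⟩ := hf
      refine ⟨∑ b, C (φ (e b)) * X b, fun w => ?_⟩
      have : φ w = φ (∑ b, e.equivFun w b • e b) := by rw [e.sum_equivFun]
      change φ w = _
      rw [this, map_sum, map_sum]
      refine Finset.sum_congr rfl fun b _ => ?_
      rw [map_smul]
      simp [mul_comm]
    | algebraMap r => exact ⟨C r, fun w => by simp⟩
    | add f g _ _ hf hg =>
      obtain ⟨p, hp⟩ := hf
      obtain ⟨q, hq⟩ := hg
      exact ⟨p + q, fun w => by simp [hp, hq]⟩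
    | mul f g _ _ hf hg =>
      obtain ⟨p, hp⟩ := hf
      obtain ⟨q, hq⟩ := hg
      exact ⟨p * q, fun w => by simp [hp, hq]⟩
  refine Set.eq_univ_of_forall fun w f hf hS => ?_
  obtain ⟨p, hp⟩ := hpoly f hf
  have hp0 : p = 0 := by
    apply hinj
    apply MvPolynomial.funext
    intro x
    have h1 := hS _ ⟨x, rfl⟩
    rw [hp, polyMap, LinearEquiv.apply_symm_apply] at h1
    rw [map_zero, ← h1, ← coe_aeval_eq_eval, ← coe_aeval_eq_eval]
    change aeval x (aeval Φ p) = aeval _ p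
    rw [← AlgHom.comp_apply, comp_aeval]
    rfl
  rw [hp, hp0, map_zero]

end PolynomialMap

end GaussianMoments
namespace GaussianMoments

open MvPolynomial

/-! ### Tangent spaces and Terracini's lemma -/

section Secants

variable {W : Type*} [AddCommGroup W] [Module ℂ W] {β : Type*} [Fintype β]
  (e : Module.Basis β ℂ W) {ι : Type*} (φ : β → MvPolynomial ι ℂ)

/-- The partial derivative of a polynomial map. -/
noncomputable def tangentVector (x : ι → ℂ) (j : ι) : W :=
  e.equivFun.symm fun b => eval x (pderiv j (φ b))

/-- The image of the differential of a polynomial map. -/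
noncomputable def tangentSpace (x : ι → ℂ) : Submodule ℂ W :=
  Submodule.span ℂ (Set.range (tangentVector e φ x))

/-- The sum of the tangent spaces at a family of points taken from a pool of points. -/
noncomputable def tangentSum {κ μ : Type*} (f : κ → μ) (X : μ × ι → ℂ) : Submodule ℂ W :=
  ⨆ k, tangentSpace e φ fun i => X (f k, i)

/-- The matrix whose columns span `tangentSum`. -/
noncomputable def secantJacobian {κ μ : Type*} (f : κ → μ) :
    Matrix β (κ × ι) (MvPolynomial (μ × ι) ℂ) :=
  Matrix.of fun b p => rename (fun i => (f p.1, i)) (pderiv p.2 (φ b))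

/-- The generic dimension of a sum of `m` tangent spaces. -/
noncomputable def secantRank [Fintype ι] (m : ℕ) : ℕ :=
  ((secantJacobian φ (id : Fin m → Fin m)).map
    (algebraMap _ (FractionRing (MvPolynomial (Fin m × ι) ℂ)))).rank

theorem tangentSum_eq_span {κ μ : Type*} (f : κ → μ) (X : μ × ι → ℂ) :
    tangentSum e φ f X = Submodule.span ℂ (Set.range fun p : κ × ι =>
      tangentVector e φ (fun i => X (f p.1, i)) p.2) := by
  rw [tangentSum]
  simp only [tangentSpace]
  rw [← Submodule.span_iUnion]
  congr 1
  ext w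
  simp

theorem finrank_tangentSum [Fintype ι] {κ μ : Type*} [Fintype κ] (f : κ → μ) (X : μ × ι → ℂ) :
    Module.finrank ℂ (tangentSum e φ f X) = ((secantJacobian φ f).map (eval X)).rank := by
  have h : tangentSum e φ f X = (Submodule.span ℂ
      (Set.range ((secantJacobian φ f).map (eval X)).col)).map
        (e.equivFun.symm : (β → ℂ) →ₗ[ℂ] W) := by
    rw [tangentSum_eq_span, Submodule.map_span, ← Set.range_comp]
    congr 2
    funext p
    simp only [tangentVector, Function.comp_apply]
    change _ = e.equivFun.symm _
    congr 1
    funext b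
    simp only [secantJacobian, Matrix.col_apply, Matrix.map_apply, Matrix.of_apply, eval_rename]
    rfl
  rw [h, Matrix.rank_eq_finrank_span_cols]
  exact LinearEquiv.finrank_map_eq e.equivFun.symm _

theorem tangentSum_comp_equiv {κ μ : Type*} {m : ℕ} (q : Fin m ≃ κ) (f : κ → μ) (X : μ × ι → ℂ) :
    tangentSum e φ f X =
      tangentSum e φ (id : Fin m → Fin m) fun p : Fin m × ι => X (f (q p.1), p.2) := by
  rw [tangentSum, tangentSum]
  exact (Equiv.iSup_comp q (g := fun k => tangentSpace e φ fun i => X (f k, i))).symm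

theorem finrank_tangentSum_le [Fintype ι] {κ μ : Type*} [Fintype κ] (f : κ → μ) (X : μ × ι → ℂ) :
    Module.finrank ℂ (tangentSum e φ f X) ≤ secantRank φ (Fintype.card κ) := by
  rw [tangentSum_comp_equiv e φ (Fintype.equivFin κ).symm f X, finrank_tangentSum]
  exact rank_eval_le_rank_fractionRing _ _

/-- Since `f` is injective, its values pick distinct points of the pool, which can be moved
independently; lower semicontinuity then spreads the maximal rank from one configuration to generic
ones. -/
theorem eventually_finrank_tangentSum [Fintype ι] {κ μ : Type*} [Fintype κ] (f : κ → μ)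
    (hf : Function.Injective f) :
    ∀ᶠ X in zariskiGeneric (μ × ι),
      Module.finrank ℂ (tangentSum e φ f X) = secantRank φ (Fintype.card κ) := by
  obtain ⟨x, hx⟩ := exists_rank_fractionRing_le_rank_eval
    (secantJacobian φ (id : Fin (Fintype.card κ) → Fin (Fintype.card κ)))
  let q := (Fintype.equivFin κ).symm
  -- A configuration `x` of maximal rank is placed at the points of the pool chosen by `f`; the
  -- other points are irrelevant and set to zero.
  let X₀ : μ × ι → ℂ := fun p =>
    Function.extend (f ∘ q) (fun k i => x (k, i)) 0 p.1 p.2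
  have hX₀ : (fun p : Fin (Fintype.card κ) × ι => X₀ (f (q p.1), p.2)) = x := by
    funext ⟨k, i⟩
    have := (hf.comp q.injective).extend_apply (fun k i => x (k, i)) 0 k
    exact congrFun this i
  have h0 : secantRank φ (Fintype.card κ) ≤ ((secantJacobian φ f).map (eval X₀)).rank := by
    rw [← finrank_tangentSum e, tangentSum_comp_equiv e φ q f, hX₀, finrank_tangentSum]
    exact hx
  filter_upwards [eventually_rank_le_rank_eval (secantJacobian φ f) X₀] with X hX
  apply le_antisymm (finrank_tangentSum_le e φ f X)
  rw [finrank_tangentSum]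
  exact h0.trans hX

section Dimension

/-- The coordinates of the sum of `m` values of a polynomial map. -/
noncomputable def sumCoordinates (m : ℕ) (b : β) : MvPolynomial (Fin m × ι) ℂ :=
  ∑ k, rename (Prod.mk k) (φ b)

-- Terracini's lemma: the summands depend on disjoint sets of variables, so the columns of the
-- Jacobian of the sum are the tangent vectors at the separate points.
omit [Fintype β] in
theorem jacobian_sumCoordinates (m : ℕ) :
    jacobian (sumCoordinates φ m) = secantJacobian φ id := by
  classical
  ext1 b ⟨k, i⟩
  simp only [jacobian, secantJacobian, sumCoordinates, Matrix.of_apply, map_sum, id]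
  rw [Finset.sum_eq_single k]
  · exact pderiv_rename (Prod.mk_right_injective k) _ _
  · intro k' _ hk
    apply pderiv_eq_zero_of_notMem_vars
    intro h
    have := vars_rename (Prod.mk k') (φ b) h
    rw [Finset.mem_image] at this
    obtain ⟨a, _, ha⟩ := this
    exact hk (congrArg Prod.fst ha)
  · simp

theorem polyMap_sumCoordinates (m : ℕ) (X : Fin m × ι → ℂ) :
    polyMap e (sumCoordinates φ m) X = ∑ k, polyMap e φ fun i => X (k, i) := by
  simp only [polyMap]
  rw [← map_sum]
  congr 1
  funext b
  simp only [sumCoordinates, map_sum, eval_rename, Finset.sum_apply]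
  rfl

theorem secantVariety_zariskiClosure_range (m : ℕ) :
    secantVariety m (zariskiClosure (Set.range (polyMap e φ))) =
      zariskiClosure (Set.range (polyMap e (sumCoordinates φ m))) := by
  rw [secantVariety_zariskiClosure]
  congr 1
  ext w
  constructor
  · rintro ⟨x, hx, rfl⟩
    choose y hy using hx
    refine ⟨fun p => y p.1 p.2, ?_⟩
    rw [polyMap_sumCoordinates]
    exact Finset.sum_congr rfl fun k _ => hy k
  · rintro ⟨X, rfl⟩
    exact ⟨fun k => polyMap e φ fun i => X (k, i), fun k => ⟨_, rfl⟩,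
      polyMap_sumCoordinates e φ m X⟩

variable [Fintype ι]

theorem varietyDim_secantVariety (m : ℕ) :
    varietyDim (secantVariety m (zariskiClosure (Set.range (polyMap e φ)))) =
      (secantRank φ m : ℕ) := by
  rw [secantVariety_zariskiClosure_range, varietyDim_eq_rank_jacobian, jacobian_sumCoordinates]
  rfl

theorem varietyDim_eq_secantRank_one :
    varietyDim (zariskiClosure (Set.range (polyMap e φ))) = (secantRank φ 1 : ℕ) := by
  rw [← varietyDim_secantVariety e, secantVariety_zariskiClosure]
  congr 2
  ext w
  simp only [Fin.sum_univ_one, Fin.forall_fin_one]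
  exact ⟨fun h => ⟨fun _ => w, h, rfl⟩, fun ⟨x, hx, hw⟩ => hw ▸ hx⟩

theorem secantVariety_eq_univ {m : ℕ} (h : secantRank φ m = Fintype.card β) :
    secantVariety m (zariskiClosure (Set.range (polyMap e φ))) = Set.univ := by
  rw [secantVariety_zariskiClosure_range]
  apply zariskiClosure_range_eq_univ
  rw [jacobian_sumCoordinates]
  exact h

end Dimension

end Secants

end GaussianMoments
namespace GaussianMoments

open MvPolynomial

/-! ### Growth of the generic dimension -/

section Stationary

variable {W : Type*} [AddCommGroup W] [Module ℂ W] {β : Type*} [Fintype β]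
  (e : Module.Basis β ℂ W) {ι : Type*} (φ : β → MvPolynomial ι ℂ)

/-- The sum of the tangent spaces at the points of a pool that are indexed by `S`. -/
noncomputable def poolSum (S : Finset ℕ) (X : ℕ × ι → ℂ) : Submodule ℂ W :=
  ⨆ k ∈ S, tangentSpace e φ fun i => X (k, i)

theorem poolSum_eq_tangentSum (S : Finset ℕ) (X : ℕ × ι → ℂ) :
    poolSum e φ S X = tangentSum e φ (Subtype.val : S → ℕ) X := by
  rw [poolSum, tangentSum, iSup_subtype']

theorem poolSum_congr {S : Finset ℕ} {X Y : ℕ × ι → ℂ} (h : ∀ k ∈ S, ∀ i, X (k, i) = Y (k, i)) :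
    poolSum e φ S X = poolSum e φ S Y := by
  rw [poolSum, poolSum]
  refine iSup_congr fun k => iSup_congr fun hk => ?_
  congr 1
  funext i
  exact h k hk i

theorem poolSum_insert (k : ℕ) (S : Finset ℕ) (X : ℕ × ι → ℂ) :
    poolSum e φ (insert k S) X = poolSum e φ {k} X ⊔ poolSum e φ S X := by
  unfold poolSum
  rw [Finset.iSup_insert, Finset.iSup_singleton]

theorem poolSum_mono {S T : Finset ℕ} (h : S ⊆ T) (X : ℕ × ι → ℂ) :
    poolSum e φ S X ≤ poolSum e φ T X :=
  biSup_mono fun _ hk => h hk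

variable [Fintype ι]

/-- Provides a single configuration in which finitely many subsets of points have the generic
dimension simultaneously, so that their sums and intersections can be compared. -/
theorem eventually_finrank_poolSum (A : Finset (Finset ℕ)) :
    ∀ᶠ X in zariskiGeneric (ℕ × ι), ∀ S ∈ A,
      Module.finrank ℂ (poolSum e φ S X) = secantRank φ S.card := by
  rw [Filter.eventually_all_finset]
  intro S _
  filter_upwards [eventually_finrank_tangentSum e φ (Subtype.val : S → ℕ)
    Subtype.val_injective] with X hX
  rw [poolSum_eq_tangentSum, hX, Fintype.card_coe]

include e

theorem secantRank_zero : secantRank φ 0 = 0 := by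
  obtain ⟨X, hX⟩ := (eventually_finrank_tangentSum e φ (Fin.elim0 : Fin 0 → ℕ)
    (fun i => i.elim0)).exists
  rw [Fintype.card_fin] at hX
  rw [← hX, tangentSum, iSup_of_empty, finrank_bot]

theorem secantRank_le (m : ℕ) : secantRank φ m ≤ Fintype.card β := by
  have := Module.Basis.finiteDimensional_of_finite e
  obtain ⟨X, hX⟩ := (eventually_finrank_poolSum e φ {Finset.range m}).exists
  have := hX _ (Finset.mem_singleton_self _)
  rw [Finset.card_range] at this
  rw [← this, ← Module.finrank_eq_card_basis e]
  exact Submodule.finrank_le _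

theorem secantRank_mono (m : ℕ) : secantRank φ m ≤ secantRank φ (m + 1) := by
  have := Module.Basis.finiteDimensional_of_finite e
  obtain ⟨X, hX⟩ :=
    (eventually_finrank_poolSum e φ {Finset.range m, Finset.range (m + 1)}).exists
  have h1 := hX (Finset.range m) (by simp)
  have h2 := hX (Finset.range (m + 1)) (by simp)
  rw [Finset.card_range] at h1 h2
  rw [← h1, ← h2]
  exact Submodule.finrank_mono (poolSum_mono e φ (by simp) X)

/-- Two families of m + 1 points sharing m of them: the sum of their tangent sums belongs to m + 2
points, the intersection contains the tangent sum at the m common points, and the dimension formula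
concludes. -/
theorem secantRank_concave (m : ℕ) :
    secantRank φ (m + 2) + secantRank φ m ≤ 2 * secantRank φ (m + 1) := by
  have := Module.Basis.finiteDimensional_of_finite e
  obtain ⟨X, hX⟩ := (eventually_finrank_poolSum e φ {Finset.range m, Finset.range (m + 1),
    insert (m + 1) (Finset.range m), Finset.range (m + 2)}).exists
  have h1 := hX (Finset.range m) (by simp)
  have h2 := hX (Finset.range (m + 1)) (by simp)
  have h3 := hX (insert (m + 1) (Finset.range m)) (by simp)
  have h4 := hX (Finset.range (m + 2)) (by simp)
  rw [Finset.card_insert_of_notMem (by simp), Finset.card_range] at h3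
  rw [Finset.card_range] at h1 h2 h4
  have h5 := Submodule.finrank_sup_add_finrank_inf_eq (poolSum e φ (Finset.range (m + 1)) X)
    (poolSum e φ (insert (m + 1) (Finset.range m)) X)
  have h6 : poolSum e φ (Finset.range m) X ≤ poolSum e φ (Finset.range (m + 1)) X ⊓
      poolSum e φ (insert (m + 1) (Finset.range m)) X :=
    le_inf (poolSum_mono e φ (by simp) X) (poolSum_mono e φ (by simp) X)
  have h7 : poolSum e φ (Finset.range (m + 2)) X = poolSum e φ (Finset.range (m + 1)) X ⊔
      poolSum e φ (insert (m + 1) (Finset.range m)) X := by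
    apply le_antisymm
    · rw [Finset.range_add_one, poolSum_insert]
      refine sup_le (le_sup_of_le_right (poolSum_mono e φ (by simp) X)) le_sup_left
    · exact sup_le (poolSum_mono e φ (by simp) X)
        (poolSum_mono e φ (Finset.insert_subset (by simp) (by simp)) X)
  have h8 := Submodule.finrank_mono h6
  rw [← h7, h4, h2, h3] at h5
  rw [h1] at h8
  omega

/-- Sliding windows: if two consecutive increments of the generic dimension agree, then a generic
tangent space meets the sums of the tangent spaces over two disjoint windows in the same space. -/
theorem eventually_inf_poolSum_eq {m : ℕ}
    (h : secantRank φ (m + 2) + secantRank φ m = 2 * secantRank φ (m + 1)) :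
    ∀ᶠ X in zariskiGeneric (ℕ × ι),
      poolSum e φ {2 * m} X ⊓ poolSum e φ (Finset.Ico 0 m) X =
        poolSum e φ {2 * m} X ⊓ poolSum e φ (Finset.Ico m (2 * m)) X ∧
      Module.finrank ℂ ↥(poolSum e φ {2 * m} X ⊓ poolSum e φ (Finset.Ico 0 m) X) +
        secantRank φ (m + 1) = secantRank φ m + secantRank φ 1 := by
  have := Module.Basis.finiteDimensional_of_finite e
  filter_upwards [eventually_finrank_poolSum e φ (Finset.range (2 * m + 1)).powerset] with X hX
  -- The dimension of the intersection with the tangent space at the point `2 * m` depends only on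
  -- the number of points in `S`.
  have hdim : ∀ S ⊆ Finset.range (2 * m),
      Module.finrank ℂ ↥(poolSum e φ {2 * m} X ⊓ poolSum e φ S X) + secantRank φ (S.card + 1) =
        secantRank φ S.card + secantRank φ 1 := by
    intro S hS
    have hy : 2 * m ∉ S := fun hy => by simpa using hS hy
    have hS' : S ⊆ Finset.range (2 * m + 1) := hS.trans (by simp)
    have h1 := hX S (by simpa using hS')
    have h2 := hX {2 * m} (by simp)
    have h3 := hX (insert (2 * m) S) (by
      rw [Finset.mem_powerset]; exact Finset.insert_subset (by simp) hS')
    rw [Finset.card_insert_of_notMem hy] at h3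
    have h4 := Submodule.finrank_sup_add_finrank_inf_eq (poolSum e φ {2 * m} X)
      (poolSum e φ S X)
    rw [← poolSum_insert, h1, h2, h3, Finset.card_singleton] at h4
    omega
  -- By `h` the intersection has the same dimension for m and for m + 1 points. So any m points of a
  -- window of length m + 1 give the same intersection as the whole window, and the window can slide
  -- by one.
  have hstep : ∀ j < m, ∀ S, S ⊆ Finset.Ico j (j + m + 1) → S.card = m →
      poolSum e φ {2 * m} X ⊓ poolSum e φ S X =
        poolSum e φ {2 * m} X ⊓ poolSum e φ (Finset.Ico j (j + m + 1)) X := by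
    intro j hj S hS hc
    have hI : Finset.Ico j (j + m + 1) ⊆ Finset.range (2 * m) := by
      intro k hk
      simp only [Finset.mem_Ico, Finset.mem_range] at hk ⊢
      omega
    have h1 := hdim S (hS.trans hI)
    have h2 := hdim _ hI
    have hcI : (Finset.Ico j (j + m + 1)).card = m + 1 := by simp; omega
    rw [hc] at h1
    rw [hcI] at h2
    apply Submodule.eq_of_le_of_finrank_eq
    · exact inf_le_inf_left _ (poolSum_mono e φ hS X)
    · have : secantRank φ (m + 1 + 1) = secantRank φ (m + 2) := rfl
      omega
  have hslide : ∀ j ≤ m, poolSum e φ {2 * m} X ⊓ poolSum e φ (Finset.Ico 0 m) X =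
      poolSum e φ {2 * m} X ⊓ poolSum e φ (Finset.Ico j (j + m)) X := by
    intro j
    induction j with
    | zero => intro _; rw [zero_add]
    | succ j ih =>
      intro hj
      rw [ih (by omega), hstep j (by omega) (Finset.Ico j (j + m))
        (Finset.Ico_subset_Ico le_rfl (by omega)) (by simp),
        hstep j (by omega) (Finset.Ico (j + 1) (j + 1 + m))
        (Finset.Ico_subset_Ico (by omega) (by omega)) (by simp)]
  constructor
  · rw [hslide m le_rfl, two_mul]
  · have := hdim (Finset.Ico 0 m) (by
      intro k hk
      simp only [Finset.mem_Ico, Finset.mem_range] at hk ⊢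
      omega)
    simpa using this

/-- If two consecutive increments of the generic dimension of the secant varieties agree and are
smaller than the first one, then the secant variety fills the space, provided that the
symmetries of the polynomial map act irreducibly. -/
theorem secantRank_eq_card_of_stationary
    (hirr : ∀ U : Submodule ℂ W,
      (∀ (Γ : ι → MvPolynomial ι ℂ) (τ : W →ₗ[ℂ] W),
        (Function.Surjective fun (x : ι → ℂ) i => eval x (Γ i)) →
        (∀ x, (tangentSpace e φ fun i => eval x (Γ i)).map τ ≤ tangentSpace e φ x) →
        U.map τ ≤ U) → U = ⊥ ∨ U = ⊤) {m : ℕ}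
    (h : secantRank φ (m + 2) + secantRank φ m = 2 * secantRank φ (m + 1))
    (hlt : secantRank φ (m + 1) < secantRank φ m + secantRank φ 1) :
    secantRank φ m = Fintype.card β := by
  classical
  have := Module.Basis.finiteDimensional_of_finite e
  set F : Finset ℕ := Finset.Ico m (2 * m)
  have hF : F.card = m := by simp [F]; omega
  -- The vectors that lie in the sum of the tangent spaces at m generic points.
  let U : Submodule ℂ W :=
    { carrier := {v | ∀ᶠ X in zariskiGeneric (ℕ × ι), v ∈ poolSum e φ F X}
      add_mem' := by
        intro a b ha hb
        change ∀ᶠ X in zariskiGeneric (ℕ × ι), _ at ha hb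
        change ∀ᶠ X in zariskiGeneric (ℕ × ι), _
        filter_upwards [ha, hb] with X h1 h2 using add_mem h1 h2
      zero_mem' := by
        change ∀ᶠ X in zariskiGeneric (ℕ × ι), _
        exact Filter.Eventually.of_forall fun X => zero_mem _
      smul_mem' := by
        intro c v hv
        change ∀ᶠ X in zariskiGeneric (ℕ × ι), _ at hv
        change ∀ᶠ X in zariskiGeneric (ℕ × ι), _
        filter_upwards [hv] with X h1 using Submodule.smul_mem _ c h1 }
  have hU : ∀ v, v ∈ U ↔ ∀ᶠ X in zariskiGeneric (ℕ × ι), v ∈ poolSum e φ F X := fun v => Iff.rfl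
  have hne : U ≠ ⊥ := by
    -- The points outside `F` are frozen at generic positions. The intersection on the first window
    -- is then a fixed nonzero space, and by the sliding argument it is contained in the tangent sum
    -- over `F` for generic positions of the points of `F`.
    let s : Set (ℕ × ι) := {p | p.1 ∉ F}
    obtain ⟨X, hX⟩ :=
      (eventually_eventually_piecewise s (eventually_inf_poolSum_eq e φ h)).exists
    have hout : ∀ S : Finset ℕ, Disjoint S F → ∀ Y,
        poolSum e φ S (s.piecewise X Y) = poolSum e φ S X := by
      intro S hS Y
      refine poolSum_congr e φ fun k hk i => ?_
      exact Set.piecewise_eq_of_mem s X Y (Finset.disjoint_left.1 hS hk)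
    have hin : ∀ Y, poolSum e φ F (s.piecewise X Y) = poolSum e φ F Y := by
      intro Y
      refine poolSum_congr e φ fun k hk i => ?_
      exact Set.piecewise_eq_of_notMem s X Y (fun hh : k ∉ F => hh hk)
    have hd1 : Disjoint {2 * m} F := by simp [F]
    have hd2 : Disjoint (Finset.Ico 0 m) F := Finset.Ico_disjoint_Ico_consecutive 0 m (2 * m)
    obtain ⟨Y₀, -, hY₀⟩ := hX.exists
    rw [hout _ hd1, hout _ hd2] at hY₀
    have hne' : poolSum e φ {2 * m} X ⊓ poolSum e φ (Finset.Ico 0 m) X ≠ ⊥ := by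
      intro h0
      rw [h0, finrank_bot] at hY₀
      omega
    obtain ⟨v, hv, hv0⟩ := Submodule.exists_mem_ne_zero_of_ne_bot hne'
    intro hbot
    apply hv0
    rw [← Submodule.mem_bot ℂ, ← hbot, hU]
    filter_upwards [hX] with Y hY
    have h1 := hY.1
    rw [hout _ hd1, hout _ hd2, hin] at h1
    rw [h1] at hv
    exact hv.2
  have hinv : U = ⊥ ∨ U = ⊤ := by
    refine hirr U fun Γ τ hΓ hτ => ?_
    rintro _ ⟨v, hv, rfl⟩
    have hv' := (hU v).1 hv
    rw [hU]
    -- The symmetry `Γ` is applied to all points of the pool at once; its surjectivity preserves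
    -- genericity.
    let Γ' : ℕ × ι → MvPolynomial (ℕ × ι) ℂ := fun p => rename (Prod.mk p.1) (Γ p.2)
    have heval : ∀ (X : ℕ × ι → ℂ) k i,
        eval X (Γ' (k, i)) = eval (fun j => X (k, j)) (Γ i) := by
      intro X k i
      simp only [Γ', eval_rename]
      rfl
    have hsurj : Function.Surjective fun (X : ℕ × ι → ℂ) p => eval X (Γ' p) := by
      intro Y
      choose Z hZ using fun k => hΓ fun i => Y (k, i)
      refine ⟨fun p => Z p.1 p.2, ?_⟩
      funext ⟨k, i⟩
      exact (heval _ k i).trans (congrFun (hZ k) i)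
    filter_upwards [eventually_comp Γ' hsurj hv'] with X hX
    have hle : (poolSum e φ F fun p => eval X (Γ' p)).map τ ≤ poolSum e φ F X := by
      rw [poolSum, Submodule.map_iSup]
      refine iSup_le fun k => ?_
      rw [Submodule.map_iSup]
      refine iSup_le fun hk => ?_
      simp only [heval]
      exact (hτ fun j => X (k, j)).trans
        (le_biSup (fun k => tangentSpace e φ fun i => X (k, i)) hk)
    exact hle (Submodule.mem_map_of_mem hX)
  have htop : U = ⊤ := hinv.resolve_left hne
  have hall : ∀ᶠ X in zariskiGeneric (ℕ × ι), ∀ b, e b ∈ poolSum e φ F X := by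
    rw [Filter.eventually_all]
    intro b
    rw [← hU, htop]
    trivial
  obtain ⟨X, hX, hX'⟩ := (hall.and (eventually_finrank_poolSum e φ {F})).exists
  have h1 : poolSum e φ F X = ⊤ := by
    rw [eq_top_iff, ← e.span_eq, Submodule.span_le]
    rintro _ ⟨b, rfl⟩
    exact hX b
  have h2 := hX' F (Finset.mem_singleton_self F)
  rw [h1, hF, finrank_top, Module.finrank_eq_card_basis e] at h2
  exact h2.symm

end Stationary

/-! ### Concave integer sequences -/

section Sequences

/-- The growth of a concave sequence of dimensions whose increments, once they fall below the
first one, decrease strictly until the sequence reaches its maximum. -/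
theorem exists_linear_growth (δ : ℕ → ℕ) (D N : ℕ) (h0 : δ 0 = 0) (h1 : δ 1 = N) (hN : 1 ≤ N)
    (hD : ∀ m, δ m ≤ D) (hmono : ∀ m, δ m ≤ δ (m + 1))
    (hconc : ∀ m, δ (m + 2) + δ m ≤ 2 * δ (m + 1))
    (hstat : ∀ m, δ (m + 2) + δ m = 2 * δ (m + 1) → δ (m + 1) < δ m + N → δ m = D) :
    ∃ k, (∀ j ≤ k, δ j = j * N) ∧ D ≤ k * N + (N - 1) * (N - 1) ∧ δ (k + (N - 1)) = D := by
  have hex : ∃ k, δ (k + 1) ≠ (k + 1) * N := by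
    by_contra! hcon
    have h2 := hcon D
    have h3 := hD (D + 1)
    rw [h2] at h3
    nlinarith
  classical
  -- The last index up to which the growth is linear.
  let k := Nat.find hex
  have hk : δ (k + 1) ≠ (k + 1) * N := Nat.find_spec hex
  have hlin : ∀ j ≤ k, δ j = j * N := by
    intro j hj
    cases j with
    | zero => simp [h0]
    | succ j =>
      by_contra hcon
      exact Nat.find_min hex (m := j) (by omega) hcon
  have hinc : ∀ m, δ (m + 1) ≤ δ m + N := by
    intro m
    induction m with
    | zero => simp [h0, h1]
    | succ m ih => have := hconc m; have : δ (m + 1 + 1) = δ (m + 2) := rfl; omega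
  have hk1 : δ (k + 1) + 1 ≤ δ k + N := by
    have h2 := hinc k
    have h3 := hlin k le_rfl
    rw [add_mul, one_mul, ← h3] at hk
    omega
  -- Unless the maximum is reached, the increment from k + i to k + i + 1 is at most N - 1 - i: it
  -- is at most N - 1 for i = 0, and by `hstat` it cannot stay constant.
  have hbound : ∀ i, δ (k + i) = D ∨ δ (k + i + 1) + i + 1 ≤ δ (k + i) + N := by
    intro i
    induction i with
    | zero => right; simpa using hk1
    | succ i ih =>
      rcases ih with ih | ih
      · left
        have h2 := hmono (k + i)
        have h3 := hD (k + i + 1)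
        have : δ (k + (i + 1)) = δ (k + i + 1) := rfl
        omega
      · have h2 := hconc (k + i)
        have e1 : δ (k + (i + 1)) = δ (k + i + 1) := rfl
        have e2 : δ (k + (i + 1) + 1) = δ (k + i + 2) := rfl
        rcases eq_or_lt_of_le h2 with h3 | h3
        · left
          have h4 := hstat (k + i) h3 (by omega)
          have h5 := hmono (k + i)
          have h6 := hD (k + i + 1)
          omega
        · right
          omega
  have hfull : δ (k + (N - 1)) = D := by
    rcases hbound (N - 1) with h2 | h2
    · exact h2
    -- For i = N - 1 the bound forces a zero increment, and concavity makes the next one zero too;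
    -- these are two equal increments below N, so `hstat` applies.
    · have h3 := hmono (k + (N - 1))
      have h4 := hmono (k + (N - 1) + 1)
      have h5 := hconc (k + (N - 1))
      have e2 : δ (k + (N - 1) + 1 + 1) = δ (k + (N - 1) + 2) := rfl
      exact hstat _ (by omega) (by omega)
  have hupper : ∀ i, δ (k + i) ≤ k * N + i * (N - 1) := by
    intro i
    induction i with
    | zero => simp [hlin k le_rfl]
    | succ i ih =>
      have e1 : δ (k + (i + 1)) = δ (k + i + 1) := rfl
      rw [add_mul, one_mul]
      rcases hbound i with h2 | h2
      · have := hD (k + i + 1)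
        omega
      · omega
  exact ⟨k, hlin, hfull ▸ hupper (N - 1), hfull⟩

end Sequences

end GaussianMoments
namespace GaussianMoments

open MvPolynomial

/-! ### Homogeneous parts of the exponential -/

section ExpPart

variable {B : Type*} [CommRing B] [Algebra ℂ B]

/-- The parts of `exp (l + q / 2)`, where `l` has degree one and `q` has degree two: the part of
degree `d` is `expPart l q (d + 1)`, and `expPart l q 0 = 0`. -/
noncomputable def expPart (l q : B) : ℕ → B
  | 0 => 0
  | 1 => 1
  | d + 2 => ((d : ℂ) + 1)⁻¹ • (l * expPart l q (d + 1) + q * expPart l q d)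

theorem expPart_add_two (l q : B) (d : ℕ) :
    expPart l q (d + 2) = ((d : ℂ) + 1)⁻¹ • (l * expPart l q (d + 1) + q * expPart l q d) := by
  rw [expPart]

theorem smul_expPart_add_two (l q : B) (d : ℕ) :
    ((d : ℂ) + 1) • expPart l q (d + 2) = l * expPart l q (d + 1) + q * expPart l q d := by
  rw [expPart_add_two, smul_smul, mul_inv_cancel₀ (Nat.cast_add_one_ne_zero d), one_smul]

theorem map_expPart {B' : Type*} [CommRing B'] [Algebra ℂ B'] (f : B →ₐ[ℂ] B') (l q : B) (d : ℕ) :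
    f (expPart l q d) = expPart (f l) (f q) d := by
  induction d using Nat.twoStepInduction with
  | zero => simp [expPart]
  | one => simp [expPart]
  | more d h1 h2 => rw [expPart_add_two, expPart_add_two, map_smul, map_add, map_mul, map_mul, h1, h2]

theorem algebraMap_two_inv_mul_two : algebraMap ℂ B 2⁻¹ * 2 = 1 := by
  rw [← map_ofNat (algebraMap ℂ B) 2, ← map_mul, inv_mul_cancel₀ two_ne_zero, map_one]

/-- The graded form of D exp(l + q/2) = (D l + D q / 2) exp(l + q/2). With s_d for `expPart l q (d +
1)`, it reads D s_{d+1} = D l · s_d + (D q / 2) s_{d-1}, and it follows by induction from the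
recurrence. -/
theorem derivation_expPart (D : Derivation ℂ B B) (l q : B) (d : ℕ) :
    D (expPart l q (d + 2)) =
      D l * expPart l q (d + 1) + (2⁻¹ : ℂ) • (D q * expPart l q d) := by
  induction d using Nat.strong_induction_on with
  | _ d ih =>
    have h0 : ((d : ℂ) + 1) ≠ 0 := Nat.cast_add_one_ne_zero d
    have key : ((d : ℂ) + 1) • D (expPart l q (d + 2)) =
        ((d : ℂ) + 1) • (D l * expPart l q (d + 1) + (2⁻¹ : ℂ) • (D q * expPart l q d)) := by
      rw [← D.map_smul, smul_expPart_add_two, map_add, D.leibniz, D.leibniz]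
      simp only [smul_eq_mul]
      match d with
      | 0 => simp [expPart, Derivation.map_one_eq_zero]
      | 1 =>
        rw [ih 0 (by omega)]
        simp [expPart, Derivation.map_one_eq_zero, Algebra.smul_def]
        have e1 : algebraMap ℂ B 2⁻¹ * 2 = 1 := algebraMap_two_inv_mul_two
        linear_combination (-D q) * e1
      | d + 2 =>
        rw [ih (d + 1) (by omega), ih d (by omega)]
        have h1 := smul_expPart_add_two l q (d + 1)
        have h2 := smul_expPart_add_two l q d
        simp only [Algebra.smul_def] at h1 h2 ⊢
        push_cast at h1 h2 ⊢
        simp only [map_ofNat] at h1 h2 ⊢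
        have e1 : algebraMap ℂ B 2⁻¹ * 2 = 1 := algebraMap_two_inv_mul_two
        have e3 : d + 1 + 2 = d + 2 + 1 := rfl
        have e4 : d + 1 + 1 = d + 2 := rfl
        rw [e3, e4] at h1
        rw [e4]
        linear_combination (-D l) * h1 - algebraMap ℂ B 2⁻¹ * D q * h2
          - D q * expPart l q (d + 2) * e1
    have := congrArg (fun b => ((d : ℂ) + 1)⁻¹ • b) key
    simpa only [smul_smul, inv_mul_cancel₀ h0, one_smul] using this

end ExpPart

/-! ### Moment forms through the recurrence -/

section Moments

variable {n : ℕ}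

theorem isHomogeneous_expPart {R : Type*} [CommRing R] [Algebra ℂ R]
    {l q : MvPolynomial (Fin n) R} (hl : l.IsHomogeneous 1) (hq : q.IsHomogeneous 2) (d : ℕ) :
    (expPart l q (d + 1)).IsHomogeneous d ∧ (expPart l q d).IsHomogeneous (d - 1) := by
  induction d with
  | zero =>
    refine ⟨isHomogeneous_one _ _, ?_⟩
    exact isHomogeneous_zero _ _ _
  | succ d ih =>
    refine ⟨?_, ih.1⟩
    rw [expPart_add_two]
    have h1 : (l * expPart l q (d + 1)).IsHomogeneous (d + 1) := by
      have h := hl.mul ih.1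
      rwa [show 1 + d = d + 1 from add_comm 1 d] at h
    have h2 : (q * expPart l q d).IsHomogeneous (d + 1) := by
      cases d with
      | zero => simp only [expPart, mul_zero]; exact isHomogeneous_zero _ _ _
      | succ d =>
        have := hq.mul ih.2
        rwa [show 2 + (d + 1 - 1) = d + 1 + 1 by omega] at this
    rw [Algebra.smul_def]
    have h3 := (isHomogeneous_C (Fin n) (algebraMap ℂ R ((d : ℂ) + 1)⁻¹)).mul (h1.add h2)
    rwa [zero_add] at h3

/-- The coefficient of `t ^ j` is homogeneous of degree `j`. -/
def IsGraded (p : Polynomial (MvPolynomial (Fin n) ℂ)) : Prop :=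
  ∀ j, (p.coeff j).IsHomogeneous j

theorem IsGraded.mul {p p' : Polynomial (MvPolynomial (Fin n) ℂ)} (hp : IsGraded p)
    (hp' : IsGraded p') : IsGraded (p * p') := by
  intro j
  rw [Polynomial.coeff_mul]
  refine IsHomogeneous.sum _ _ _ fun a ha => ?_
  rw [← Finset.HasAntidiagonal.mem_antidiagonal.1 ha]
  exact (hp _).mul (hp' _)

theorem IsGraded.pow {p : Polynomial (MvPolynomial (Fin n) ℂ)} (hp : IsGraded p) (k : ℕ) :
    IsGraded (p ^ k) := by
  induction k with
  | zero =>
    intro j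
    rw [pow_zero, Polynomial.coeff_one]
    split_ifs with h
    · rw [h]; exact isHomogeneous_one _ _
    · exact isHomogeneous_zero _ _ _
  | succ k ih => rw [pow_succ]; exact ih.mul hp

theorem IsGraded.homogeneousComponent_eval {p : Polynomial (MvPolynomial (Fin n) ℂ)}
    (hp : IsGraded p) (d : ℕ) : homogeneousComponent d (p.eval 1) = p.coeff d := by
  rw [Polynomial.eval_eq_sum_range]
  simp only [one_pow, mul_one, map_sum]
  simp_rw [fun j => homogeneousComponent_of_mem (m := d) (hp j)]
  rw [Finset.sum_ite_eq]
  split_ifs with h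
  · rfl
  · rw [Finset.mem_range, not_lt] at h
    exact (Polynomial.coeff_eq_zero_of_natDegree_lt (by omega)).symm

/-- For u = l t + q t²/2 one has (exp u)' = (l + q t) exp u, and comparing coefficients of t^d gives
the recurrence that defines `expPart`. For truncated series, differentiation lowers the number of
terms by one, which is why all K > d are treated together. -/
theorem coeff_exp_eq_expPart {B : Type*} [CommRing B] [Algebra ℂ B] (l q : B) (d : ℕ) :
    ∀ K, d < K → (∑ k ∈ Finset.range K, ((k.factorial : ℂ)⁻¹) •
      (Polynomial.C l * Polynomial.X + Polynomial.C ((2⁻¹ : ℂ) • q) * Polynomial.X ^ 2) ^ k).coeff d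
        = expPart l q (d + 1) := by
  set u : Polynomial B :=
    Polynomial.C l * Polynomial.X + Polynomial.C ((2⁻¹ : ℂ) • q) * Polynomial.X ^ 2 with hu
  have hu' : Polynomial.derivative u = Polynomial.C l + Polynomial.C q * Polynomial.X := by
    have : (2 : Polynomial B) = Polynomial.C (algebraMap ℂ B 2) := by rw [map_ofNat, map_ofNat]
    simp only [hu, Polynomial.derivative_add, Polynomial.derivative_C_mul,
      Polynomial.derivative_X, Polynomial.derivative_X_pow]
    simp only [Nat.cast_ofNat, Nat.add_one_sub_one, pow_one, mul_one, map_ofNat]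
    rw [this, ← mul_assoc, ← Polynomial.C_mul, Algebra.smul_def, mul_right_comm, ← map_mul]
    norm_num
  have hderiv : ∀ K, Polynomial.derivative (∑ k ∈ Finset.range (K + 1),
      ((k.factorial : ℂ)⁻¹) • u ^ k) = (Polynomial.C l + Polynomial.C q * Polynomial.X) *
        ∑ k ∈ Finset.range K, ((k.factorial : ℂ)⁻¹) • u ^ k := by
    intro K
    rw [Finset.sum_range_succ', map_add, map_sum, Finset.mul_sum]
    simp only [pow_zero, Nat.factorial_zero, Nat.cast_one, inv_one, one_smul,
      Polynomial.derivative_one, add_zero]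
    refine Finset.sum_congr rfl fun k _ => ?_
    rw [Polynomial.derivative_smul, Polynomial.derivative_pow_succ, hu', mul_smul_comm]
    have h1 : (((k + 1).factorial : ℂ)⁻¹) = ((k.factorial : ℂ)⁻¹) * ((k : ℂ) + 1)⁻¹ := by
      rw [Nat.factorial_succ]
      push_cast
      rw [mul_inv, mul_comm]
    have h2 : Polynomial.C ((k : B) + 1) = algebraMap ℂ (Polynomial B) ((k : ℂ) + 1) := by
      simp
    rw [h1, h2, mul_assoc, ← Algebra.smul_def, smul_smul, mul_assoc,
      inv_mul_cancel₀ (Nat.cast_add_one_ne_zero k), mul_one, mul_comm (u ^ k)]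
  have hzero : ∀ K, 0 < K →
      (∑ k ∈ Finset.range K, ((k.factorial : ℂ)⁻¹) • u ^ k).coeff 0 = 1 := by
    intro K hK
    obtain ⟨K, rfl⟩ : ∃ K', K = K' + 1 := ⟨K - 1, by omega⟩
    rw [Finset.sum_range_succ', Polynomial.coeff_add, Polynomial.finsetSum_coeff,
      Finset.sum_eq_zero]
    · simp
    · intro k _
      rw [Polynomial.coeff_smul, Polynomial.coeff_zero_eq_eval_zero, Polynomial.eval_pow]
      simp [hu]
  have hstep : ∀ d K : ℕ, ((d : ℂ) + 1) •
      (∑ k ∈ Finset.range (K + 1), ((k.factorial : ℂ)⁻¹) • u ^ k).coeff (d + 1) =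
        l * (∑ k ∈ Finset.range K, ((k.factorial : ℂ)⁻¹) • u ^ k).coeff d +
        q * (Polynomial.X * ∑ k ∈ Finset.range K, ((k.factorial : ℂ)⁻¹) • u ^ k).coeff d := by
    intro d K
    have h := congrArg (fun p => Polynomial.coeff p d) (hderiv K)
    simp only [Polynomial.coeff_derivative, add_mul, mul_assoc, Polynomial.coeff_add,
      Polynomial.coeff_C_mul] at h
    rw [← h, Algebra.smul_def, mul_comm]
    simp
  have hinv : ∀ (d : ℕ) (x : B), x = ((d : ℂ) + 1)⁻¹ • (((d : ℂ) + 1) • x) := by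
    intro d x
    rw [smul_smul, inv_mul_cancel₀ (Nat.cast_add_one_ne_zero d), one_smul]
  induction d using Nat.twoStepInduction with
  | zero => exact hzero
  | one =>
    intro K hK
    obtain ⟨K, rfl⟩ : ∃ K', K = K' + 1 := ⟨K - 1, by omega⟩
    rw [hinv 0 (Polynomial.coeff _ _), hstep 0 K, hzero K (by omega),
      Polynomial.coeff_X_mul_zero]
    rfl
  | more d h1 h2 =>
    intro K hK
    obtain ⟨K, rfl⟩ : ∃ K', K = K' + 1 := ⟨K - 1, by omega⟩
    rw [hinv (d + 1) (Polynomial.coeff _ _), hstep (d + 1) K, Polynomial.coeff_X_mul,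
      h1 K (by omega), h2 K (by omega)]
    rfl

/-- The auxiliary variable t records the degree: in l t + q t²/2 and its powers the coefficient of
t^j is homogeneous of degree j, so after setting t = 1 the part of degree d is the coefficient of
t^d. -/
theorem coe_gaussianMoment (d : ℕ) (l : Forms 1 n) (q : Forms 2 n) :
    (gaussianMoment d l q : MvPolynomial (Fin n) ℂ) = expPart (l : MvPolynomial (Fin n) ℂ) q (d + 1) := by
  rw [← coeff_exp_eq_expPart _ _ d (d + 1) (Nat.lt_succ_self d)]
  set u : Polynomial (MvPolynomial (Fin n) ℂ) :=
    Polynomial.C (l : MvPolynomial (Fin n) ℂ) * Polynomial.X +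
      Polynomial.C ((2⁻¹ : ℂ) • (q : MvPolynomial (Fin n) ℂ)) * Polynomial.X ^ 2 with hu
  have hug : IsGraded u := by
    intro j
    simp only [hu, Polynomial.coeff_add, Polynomial.coeff_C_mul, Polynomial.coeff_X,
      Polynomial.coeff_X_pow]
    refine IsHomogeneous.add ?_ ?_
    · split_ifs with h
      · rw [← h, mul_one]; exact l.2
      · rw [mul_zero]; exact isHomogeneous_zero _ _ _
    · split_ifs with h
      · rw [h, mul_one]; exact Submodule.smul_mem _ _ q.2
      · rw [mul_zero]; exact isHomogeneous_zero _ _ _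
  have hG : IsGraded (∑ k ∈ Finset.range (d + 1), ((k.factorial : ℂ)⁻¹) • u ^ k) := by
    intro j
    rw [Polynomial.finsetSum_coeff]
    refine IsHomogeneous.sum _ _ _ fun k _ => ?_
    rw [Polynomial.coeff_smul]
    exact Submodule.smul_mem (homogeneousSubmodule (Fin n) ℂ j) _ (hug.pow k j)
  rw [← hG.homogeneousComponent_eval, gaussianMoment]
  simp only [Polynomial.eval_finsetSum, Polynomial.eval_smul, Polynomial.eval_pow]
  simp [hu]

end Moments

end GaussianMoments
namespace GaussianMoments

open MvPolynomial

/-! ### Forms and their coefficients -/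

section FormsBasis

variable (d n : ℕ)

/-- The exponents of the monomials of degree `d` in `n` variables. -/
abbrev Exponents : Type := ↥(Finset.univ.finsuppAntidiag d : Finset (Fin n →₀ ℕ))

variable {d n}

theorem mem_exponents {b : Fin n →₀ ℕ} :
    b ∈ (Finset.univ.finsuppAntidiag d : Finset (Fin n →₀ ℕ)) ↔ b.degree = d := by
  rw [Finset.mem_finsuppAntidiag, Finsupp.degree_eq_sum]
  simp

variable (d n) in
/-- A form is given by its coefficients. -/
noncomputable def formsEquiv : Forms d n ≃ₗ[ℂ] (Exponents d n → ℂ) where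
  toFun p b := coeff b.1 (p : MvPolynomial (Fin n) ℂ)
  map_add' _ _ := by ext; simp
  map_smul' _ _ := by ext; simp
  invFun f := ⟨∑ b : Exponents d n, monomial b.1 (f b), by
    rw [mem_homogeneousSubmodule]
    exact IsHomogeneous.sum _ _ _ fun b _ => isHomogeneous_monomial _ (mem_exponents.1 b.2)⟩
  left_inv p := by
    apply Subtype.ext
    apply MvPolynomial.ext
    intro m
    simp only [coeff_sum, coeff_monomial]
    by_cases hm : m.degree = d
    · rw [Finset.sum_eq_single (⟨m, mem_exponents.2 hm⟩ : Exponents d n)]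
      · simp
      · intro b _ hb
        rw [if_neg fun h => hb (Subtype.ext h)]
      · simp
    · rw [Finset.sum_eq_zero]
      · exact ((mem_homogeneousSubmodule _ _).1 p.2 |>.coeff_eq_zero hm).symm
      · intro b _
        rw [if_neg]
        rintro rfl
        exact hm (mem_exponents.1 b.2)
  right_inv f := by
    ext b
    simp only [coeff_sum, coeff_monomial]
    rw [Finset.sum_eq_single b]
    · simp
    · intro b' _ hb
      rw [if_neg fun h => hb (Subtype.ext h)]
    · simp

variable (d n) in
/-- The basis of monomials. -/
noncomputable def formsBasis : Module.Basis (Exponents d n) ℂ (Forms d n) :=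
  Module.Basis.ofEquivFun (formsEquiv d n)

theorem coeff_formsBasis_equivFun_symm (f : Exponents d n → ℂ) (b : Exponents d n) :
    coeff b.1 (((formsBasis d n).equivFun.symm f : Forms d n) : MvPolynomial (Fin n) ℂ) = f b := by
  have h : (formsBasis d n).equivFun = formsEquiv d n := by
    rw [formsBasis, Module.Basis.equivFun_ofEquivFun]
  rw [h]
  exact congrFun ((formsEquiv d n).apply_symm_apply f) b

theorem forms_ext {p : Forms d n} {q : MvPolynomial (Fin n) ℂ} (hq : q.IsHomogeneous d)
    (h : ∀ b : Exponents d n, coeff b.1 (p : MvPolynomial (Fin n) ℂ) = coeff b.1 q) :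
    (p : MvPolynomial (Fin n) ℂ) = q := by
  apply MvPolynomial.ext
  intro m
  by_cases hm : m.degree = d
  · exact h ⟨m, mem_exponents.2 hm⟩
  · rw [((mem_homogeneousSubmodule _ _).1 p.2).coeff_eq_zero hm, hq.coeff_eq_zero hm]

instance : FiniteDimensional ℂ (Forms d n) := (formsBasis d n).finiteDimensional_of_finite

end FormsBasis

/-! ### Differentiating the coefficients of a polynomial -/

section CoefficientDerivation

variable {R A τ : Type*} [CommRing R] [CommRing A] [Algebra R A]

theorem coeff_sum_support (D : Derivation R A A) (p : MvPolynomial τ A) (m : τ →₀ ℕ) :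
    coeff m (∑ m ∈ p.support, monomial m (D (coeff m p))) = D (coeff m p) := by
  classical
  simp only [coeff_sum, coeff_monomial, Finset.sum_ite_eq']
  split_ifs with h
  · rfl
  · rw [notMem_support_iff.1 h, map_zero]

/-- A derivation of the coefficients, extended to polynomials. -/
noncomputable def coeffDerivation (D : Derivation R A A) :
    Derivation R (MvPolynomial τ A) (MvPolynomial τ A) :=
  Derivation.mk'
    { toFun := fun p => ∑ m ∈ p.support, monomial m (D (coeff m p))
      map_add' := fun p q => by
        ext m
        rw [coeff_add, coeff_sum_support, coeff_sum_support, coeff_sum_support, coeff_add, map_add]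
      map_smul' := fun c p => by
        ext m
        rw [RingHom.id_apply, coeff_smul, coeff_sum_support, coeff_sum_support, coeff_smul,
          D.map_smul] }
    fun p q => by
      classical
      ext m
      change coeff m (∑ m ∈ (p * q).support, monomial m (D (coeff m (p * q)))) =
        coeff m (p • (∑ m ∈ q.support, monomial m (D (coeff m q))) +
          q • ∑ m ∈ p.support, monomial m (D (coeff m p)))
      rw [coeff_sum_support, smul_eq_mul, smul_eq_mul, mul_comm q, coeff_add, coeff_mul, coeff_mul,
        coeff_mul, map_sum, ← Finset.sum_add_distrib]
      refine Finset.sum_congr rfl fun a _ => ?_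
      rw [coeff_sum_support, coeff_sum_support, D.leibniz, smul_eq_mul, smul_eq_mul,
        mul_comm (coeff a.2 q)]

theorem coeff_coeffDerivation (D : Derivation R A A) (p : MvPolynomial τ A) (m : τ →₀ ℕ) :
    coeff m (coeffDerivation D p) = D (coeff m p) :=
  coeff_sum_support D p m

theorem coeffDerivation_C (D : Derivation R A A) (a : A) :
    coeffDerivation D (C a : MvPolynomial τ A) = C (D a) := by
  classical
  ext m
  rw [coeff_coeffDerivation, coeff_C, coeff_C, apply_ite D, map_zero]

theorem coeffDerivation_X (D : Derivation R A A) (i : τ) :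
    coeffDerivation D (X i : MvPolynomial τ A) = 0 := by
  classical
  ext m
  rw [coeff_coeffDerivation, coeff_X, apply_ite D, map_zero, D.map_one_eq_zero, ite_self, coeff_zero]

end CoefficientDerivation

end GaussianMoments
namespace GaussianMoments

open MvPolynomial

/-! ### The parametrization and its tangent vectors -/

section Parametrization

variable {n r : ℕ}

/-- The linear form with given coefficients. -/
noncomputable def linForm {R : Type*} [CommRing R] (c : Fin n → R) : MvPolynomial (Fin n) R :=
  ∑ i, C (c i) * X i

theorem isHomogeneous_linForm {R : Type*} [CommRing R] (c : Fin n → R) :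
    (linForm c).IsHomogeneous 1 :=
  IsHomogeneous.sum _ _ _ fun i _ => by
    simpa using (isHomogeneous_C (Fin n) (c i)).mul (isHomogeneous_X R i)

theorem map_linForm {R S : Type*} [CommRing R] [CommRing S] (f : R →+* S) (c : Fin n → R) :
    map f (linForm c) = linForm fun i => f (c i) := by
  simp [linForm]

/-- The quadratic form which is the sum of the squares of the linear forms given by `x`. -/
noncomputable def sumSquares {R : Type*} [CommRing R] (x : Option (Fin r) × Fin n → R) :
    MvPolynomial (Fin n) R :=
  ∑ a : Fin r, linForm (fun i => x (some a, i)) ^ 2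

theorem isHomogeneous_sumSquares {R : Type*} [CommRing R] (x : Option (Fin r) × Fin n → R) :
    (sumSquares x).IsHomogeneous 2 :=
  IsHomogeneous.sum _ _ _ fun _ _ => (isHomogeneous_linForm _).pow 2

theorem map_sumSquares {R S : Type*} [CommRing R] [CommRing S] (f : R →+* S)
    (x : Option (Fin r) × Fin n → R) :
    map f (sumSquares x) = sumSquares fun p => f (x p) := by
  simp [sumSquares, map_linForm]

/-- The part of degree `d - 1` of `exp (l + q / 2)`, where `l` and `q` are given by the
parameters `x`. -/
noncomputable def momentForm {R : Type*} [CommRing R] [Algebra ℂ R]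
    (x : Option (Fin r) × Fin n → R) (d : ℕ) : MvPolynomial (Fin n) R :=
  expPart (linForm fun i => x (none, i)) (sumSquares x) d

theorem isHomogeneous_momentForm {R : Type*} [CommRing R] [Algebra ℂ R]
    (x : Option (Fin r) × Fin n → R) (d : ℕ) : (momentForm x (d + 1)).IsHomogeneous d :=
  (isHomogeneous_expPart (isHomogeneous_linForm _) (isHomogeneous_sumSquares x) d).1

theorem map_momentForm {R S : Type*} [CommRing R] [CommRing S] [Algebra ℂ R] [Algebra ℂ S]
    (f : R →ₐ[ℂ] S) (x : Option (Fin r) × Fin n → R) (d : ℕ) :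
    map (f : R →+* S) (momentForm x d) = momentForm (fun p => f (x p)) d := by
  have h := map_expPart (mapAlgHom (σ := Fin n) f) (linForm fun i => x (none, i)) (sumSquares x) d
  simp only [mapAlgHom_apply] at h
  rw [momentForm, momentForm]
  refine h.trans ?_
  congr 1
  · exact map_linForm (f : R →+* S) _
  · exact map_sumSquares (f : R →+* S) x

variable (n r) in
/-- The coefficients of the moment form as polynomials in the parameters. -/
noncomputable def momentCoords (d : ℕ) (b : Exponents d n) :
    MvPolynomial (Option (Fin r) × Fin n) ℂ :=
  coeff b.1 (momentForm (X : Option (Fin r) × Fin n → MvPolynomial _ ℂ) (d + 1))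

theorem map_eval_momentForm (x : Option (Fin r) × Fin n → ℂ) (d : ℕ) :
    map (eval x) (momentForm (X : Option (Fin r) × Fin n → MvPolynomial _ ℂ) d) =
      momentForm x d := by
  have h := map_momentForm (aeval x) (X : Option (Fin r) × Fin n → MvPolynomial _ ℂ) d
  simp only [aeval_X] at h
  rw [← h]
  rfl

theorem coe_polyMap_momentCoords (d : ℕ) (x : Option (Fin r) × Fin n → ℂ) :
    ((polyMap (formsBasis d n) (momentCoords n r d) x : Forms d n) : MvPolynomial (Fin n) ℂ) =
      momentForm x (d + 1) := by
  refine forms_ext (isHomogeneous_momentForm x d) fun b => ?_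
  rw [polyMap, coeff_formsBasis_equivFun_symm, momentCoords, ← map_eval_momentForm x, coeff_map]

/-- Differentiating the coefficients with respect to a parameter is a derivation of the ring of
forms over the parameter ring. Thus the tangent vectors can be computed with `derivation_expPart`,
without expanding coefficients. -/
theorem coe_tangentVector (d : ℕ) (x : Option (Fin r) × Fin n → ℂ) (j : Option (Fin r) × Fin n) :
    ((tangentVector (formsBasis (d + 1) n) (momentCoords n r (d + 1)) x j :
      Forms (d + 1) n) : MvPolynomial (Fin n) ℂ) =
      map (eval x) (coeffDerivation (pderiv j)
        (momentForm (X : Option (Fin r) × Fin n → MvPolynomial _ ℂ) (d + 2))) := by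
  apply MvPolynomial.ext
  intro m
  rw [coeff_map, coeff_coeffDerivation]
  by_cases hm : m.degree = d + 1
  · exact coeff_formsBasis_equivFun_symm _ ⟨m, mem_exponents.2 hm⟩
  · rw [((mem_homogeneousSubmodule _ _).1 (Subtype.mem _)).coeff_eq_zero hm,
      (isHomogeneous_momentForm _ _).coeff_eq_zero hm, map_zero, map_zero]

theorem coeffDerivation_linForm (j : Option (Fin r) × Fin n) (o : Option (Fin r)) :
    coeffDerivation (pderiv j) (linForm fun i =>
      (X (o, i) : MvPolynomial (Option (Fin r) × Fin n) ℂ)) =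
        if j.1 = o then X j.2 else 0 := by
  rw [linForm, map_sum]
  simp only [Derivation.leibniz, coeffDerivation_C, coeffDerivation_X, pderiv_X, smul_eq_mul,
    mul_zero, zero_add]
  obtain ⟨p, k⟩ := j
  split_ifs with h
  · subst h
    rw [Finset.sum_eq_single k]
    · simp
    · intro i _ hi
      rw [Pi.single_eq_of_ne (by simp [hi]), map_zero, mul_zero]
    · simp
  · refine Finset.sum_eq_zero fun i _ => ?_
    rw [Pi.single_eq_of_ne (by simp [Ne.symm h]), map_zero, mul_zero]

theorem coe_tangentVector_none (d : ℕ) (x : Option (Fin r) × Fin n → ℂ) (i : Fin n) :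
    ((tangentVector (formsBasis (d + 1) n) (momentCoords n r (d + 1)) x (none, i) :
      Forms (d + 1) n) : MvPolynomial (Fin n) ℂ) = X i * momentForm x (d + 1) := by
  have hq : coeffDerivation (pderiv (none, i))
      (sumSquares (X : Option (Fin r) × Fin n → MvPolynomial _ ℂ)) = 0 := by
    simp only [sumSquares, map_sum, Derivation.leibniz_pow, coeffDerivation_linForm]
    simp
  rw [coe_tangentVector, ← map_eval_momentForm, momentForm, momentForm, derivation_expPart,
    coeffDerivation_linForm, hq, zero_mul, smul_zero, add_zero, if_pos rfl, map_mul, map_X]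

theorem coe_tangentVector_some (d : ℕ) (x : Option (Fin r) × Fin n → ℂ) (a : Fin r) (i : Fin n) :
    ((tangentVector (formsBasis (d + 1) n) (momentCoords n r (d + 1)) x (some a, i) :
      Forms (d + 1) n) : MvPolynomial (Fin n) ℂ) =
        linForm (fun i => x (some a, i)) * X i * momentForm x d := by
  have hq : coeffDerivation (pderiv (some a, i))
      (sumSquares (X : Option (Fin r) × Fin n → MvPolynomial _ ℂ)) =
      (2 : ℂ) • (linForm (fun i => X (some a, i)) * X i) := by
    simp only [sumSquares, map_sum, Derivation.leibniz_pow, coeffDerivation_linForm]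
    rw [Finset.sum_eq_single a]
    · simp only [if_true, Nat.add_one_sub_one, pow_one, smul_eq_mul, ofNat_smul_eq_nsmul]
    · intro a' _ ha
      rw [if_neg fun h => ha (Option.some_injective _ h).symm, smul_zero, smul_zero]
    · simp
  rw [coe_tangentVector, ← map_eval_momentForm x d, momentForm, momentForm, derivation_expPart,
    coeffDerivation_linForm, hq, if_neg (by simp), zero_mul, zero_add, smul_mul_assoc, smul_smul,
    inv_mul_cancel₀ two_ne_zero, one_smul, map_mul, map_mul, map_X, map_linForm]
  simp only [eval_X]

end Parametrization

end GaussianMoments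
namespace GaussianMoments

open MvPolynomial

/-! ### Irreducibility of the space of forms -/

section Shears

variable {n : ℕ}

/-- The substitution `X i ↦ X i + t X j`. -/
noncomputable def shear (i j : Fin n) (t : ℂ) : MvPolynomial (Fin n) ℂ →ₐ[ℂ] MvPolynomial (Fin n) ℂ :=
  aeval fun k => X k + if k = i then C t * X j else 0

theorem isHomogeneous_shear (i j : Fin n) (t : ℂ) {d : ℕ} {p : MvPolynomial (Fin n) ℂ}
    (hp : p.IsHomogeneous d) : (shear i j t p).IsHomogeneous d := by
  have := hp.aeval (fun k => X k + if k = i then C t * X j else 0) (n := 1) fun k => by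
    refine (isHomogeneous_X _ _).add ?_
    split_ifs
    · simpa using (isHomogeneous_C (Fin n) t).mul (isHomogeneous_X ℂ j)
    · exact isHomogeneous_zero _ _ _
  rwa [one_mul] at this

/-- The action of a shear on forms. -/
noncomputable def shearForms (d : ℕ) (i j : Fin n) (t : ℂ) : Forms d n →ₗ[ℂ] Forms d n :=
  (shear i j t).toLinearMap.restrict fun _ hp => isHomogeneous_shear i j t hp

/-- A linear functional that vanishes on `M` turns `F` into a scalar polynomial with infinitely many
zeros, so it vanishes on every coefficient. -/
theorem coeff_mem_of_eval_mem {M : Submodule ℂ (MvPolynomial (Fin n) ℂ)}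
    (F : Polynomial (MvPolynomial (Fin n) ℂ)) (h : ∀ t : ℂ, F.eval (C t) ∈ M) (k : ℕ) :
    F.coeff k ∈ M := by
  by_contra hcon
  obtain ⟨f, hf, hM⟩ := Submodule.exists_le_ker_of_notMem hcon
  let g : Polynomial ℂ := ∑ j ∈ Finset.range (F.natDegree + 1),
    Polynomial.monomial j (f (F.coeff j))
  have hg : g = 0 := by
    apply Polynomial.funext
    intro t
    have h1 : f (F.eval (C t)) = 0 := hM (h t)
    rw [Polynomial.eval_eq_sum_range, map_sum] at h1
    rw [Polynomial.eval_finsetSum, Polynomial.eval_zero, ← h1]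
    refine Finset.sum_congr rfl fun j _ => ?_
    rw [Polynomial.eval_monomial, ← C_pow, mul_comm (F.coeff j), ← smul_eq_C_mul, map_smul,
      smul_eq_mul, mul_comm]
  apply hf
  have h2 := congrArg (fun p => Polynomial.coeff p k) hg
  simp only [g, Polynomial.finsetSum_coeff, Polynomial.coeff_monomial, Finset.sum_ite_eq',
    Polynomial.coeff_zero] at h2
  split_ifs at h2 with h3
  · exact h2
  · rw [Finset.mem_range, not_lt] at h3
    rw [Polynomial.coeff_eq_zero_of_natDegree_lt (by omega), map_zero]

/-- A space of polynomials that is invariant under shears is invariant under the corresponding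
first order differential operators. -/
theorem X_mul_pderiv_mem {M : Submodule ℂ (MvPolynomial (Fin n) ℂ)} {i j : Fin n}
    (hM : ∀ t, ∀ p ∈ M, shear i j t p ∈ M) {p : MvPolynomial (Fin n) ℂ} (hp : p ∈ M) :
    X j * pderiv i p ∈ M := by
  -- The shear with t as an indeterminate; its coefficient of t is X_j ∂_i p.
  let F : MvPolynomial (Fin n) ℂ →ₐ[ℂ] Polynomial (MvPolynomial (Fin n) ℂ) :=
    aeval fun k => Polynomial.C (X k) + if k = i then Polynomial.X * Polynomial.C (X j) else 0
  have heval : ∀ t p, (F p).eval (C t) = shear i j t p := by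
    intro t p
    have : ((Polynomial.aeval (R := MvPolynomial (Fin n) ℂ)
        (C t : MvPolynomial (Fin n) ℂ)).restrictScalars ℂ).comp F = shear i j t := by
      apply MvPolynomial.algHom_ext
      intro k
      simp only [F, shear, AlgHom.comp_apply, aeval_X]
      split_ifs <;> simp [mul_comm (X j) (C t)]
    rw [← this]
    simp
  have hcoeff : ∀ p, (F p).coeff 0 = p ∧ (F p).coeff 1 = X j * pderiv i p := by
    intro p
    induction p using MvPolynomial.induction_on with
    | C a =>
      have : F (C a) = Polynomial.C (C a) := by
        rw [← MvPolynomial.algebraMap_eq, AlgHom.commutes]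
        rfl
      rw [this]
      simp [Polynomial.coeff_C]
    | add p q hp hq => simp [hp, hq, mul_add]
    | mul_X p k hp =>
      have hX : (F (X k)).coeff 0 = X k ∧ (F (X k)).coeff 1 = X j * pderiv i (X k) := by
        simp only [F, aeval_X, pderiv_X]
        split_ifs with h
        · subst h; simp [Polynomial.coeff_C]
        · simp [Polynomial.coeff_C, h]
      rw [map_mul, Polynomial.mul_coeff_zero, Polynomial.mul_coeff_one, hp.1, hp.2, hX.1, hX.2,
        pderiv_mul]
      exact ⟨rfl, by ring⟩
  rw [← (hcoeff p).2]
  exact coeff_mem_of_eval_mem (F p) (fun t => by rw [heval]; exact hM t p hp) 1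

variable {d : ℕ}

/-- Choose a nonzero f in `M` divisible by the highest possible power of X_{i₀}. For i ≠ i₀ the
element X_{i₀} ∂_i f of `M` is divisible by a higher power, so it is zero. Thus f involves only
X_{i₀}. -/
theorem exists_monomial_mem (i₀ : Fin n) {M : Submodule ℂ (MvPolynomial (Fin n) ℂ)}
    (hhom : ∀ p ∈ M, p.IsHomogeneous d)
    (hM : ∀ i j, i ≠ j → ∀ p ∈ M, X j * pderiv i p ∈ M) (hne : M ≠ ⊥) :
    (monomial (Finsupp.single i₀ d) 1 : MvPolynomial (Fin n) ℂ) ∈ M := by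
  classical
  have hdeg : ∀ k, ∀ f ∈ M, f ≠ 0 → (X i₀ ^ k : MvPolynomial (Fin n) ℂ) ∣ f → k ≤ d := by
    rintro k f hf hf0 ⟨g, rfl⟩
    have h1 := (hhom _ hf).totalDegree hf0
    rw [totalDegree_mul_of_isDomain (left_ne_zero_of_mul hf0) (right_ne_zero_of_mul hf0),
      totalDegree_X_pow] at h1
    omega
  let P : ℕ → Prop := fun k => ∃ f ∈ M, f ≠ 0 ∧ (X i₀ ^ k : MvPolynomial (Fin n) ℂ) ∣ f
  have hP0 : P 0 := by
    obtain ⟨f, hf, hf0⟩ := Submodule.exists_mem_ne_zero_of_ne_bot hne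
    exact ⟨f, hf, hf0, by simp⟩
  obtain ⟨f, hf, hf0, g, hg⟩ := Nat.findGreatest_spec (Nat.zero_le d) hP0
  set k := Nat.findGreatest P d
  have hpd : ∀ i, i ≠ i₀ → pderiv i f = 0 := by
    intro i hi
    by_contra hcon
    have h1 : P (k + 1) := by
      refine ⟨X i₀ * pderiv i f, hM i i₀ hi f hf, mul_ne_zero (X_ne_zero _) hcon, ?_⟩
      rw [pow_succ', hg, pderiv_mul, pderiv_pow, pderiv_X_of_ne (Ne.symm hi), mul_zero, zero_mul,
        zero_add]
      exact mul_dvd_mul_left _ (dvd_mul_right _ _)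
    obtain ⟨f', hf', hf0', hd'⟩ := h1
    have h2 := hdeg _ f' hf' hf0' hd'
    have h3 := Nat.le_findGreatest (P := P) h2 ⟨f', hf', hf0', hd'⟩
    omega
  have hcoeff : ∀ m : Fin n →₀ ℕ, coeff m f ≠ 0 → m = Finsupp.single i₀ d := by
    intro m hm
    have h0 : ∀ i, i ≠ i₀ → m i = 0 := by
      intro i hi
      by_contra hmi
      have h1 : Finsupp.single i 1 ≤ m := by
        rw [Finsupp.single_le_iff]; omega
      have h2 := coeff_pderiv (i := i) f (m - Finsupp.single i 1)
      rw [hpd i hi, coeff_zero, tsub_add_cancel_of_le h1] at h2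
      rcases mul_eq_zero.1 h2.symm with h3 | h3
      · exact hm h3
      · exact Nat.cast_add_one_ne_zero _ h3
    have h1 : m.degree = d := by
      by_contra h1
      exact hm ((hhom f hf).coeff_eq_zero h1)
    have h2 : m = Finsupp.single i₀ (m i₀) := by
      ext i
      by_cases hi : i = i₀
      · subst hi; simp
      · rw [h0 i hi, Finsupp.single_eq_of_ne hi]
    rw [h2, Finsupp.degree_single] at h1
    rw [h2, h1]
  obtain ⟨m, hm⟩ := ne_zero_iff.1 hf0
  have hm' := hcoeff m hm
  subst hm'
  have hfe : f = coeff (Finsupp.single i₀ d) f • monomial (Finsupp.single i₀ d) 1 := by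
    apply MvPolynomial.ext
    intro m
    rw [coeff_smul, coeff_monomial]
    split_ifs with h
    · rw [h]; simp
    · by_contra hcon
      simp only [smul_zero] at hcon
      exact h (hcoeff m hcon).symm
  rw [hfe] at hf
  exact (Submodule.smul_mem_iff _ hm).1 hf

/-- The operator X_j ∂_{i₀} trades one factor X_{i₀} for X_j, up to a nonzero scalar. Starting from
the pure power, N such trades reach a monomial with N factors other than X_{i₀}. -/
theorem monomial_mem (i₀ : Fin n) {M : Submodule ℂ (MvPolynomial (Fin n) ℂ)}
    (hM : ∀ i j, i ≠ j → ∀ p ∈ M, X j * pderiv i p ∈ M)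
    (h0 : (monomial (Finsupp.single i₀ d) 1 : MvPolynomial (Fin n) ℂ) ∈ M) :
    ∀ N, ∀ m : Fin n →₀ ℕ, m.degree = d → m i₀ + N = d →
      (monomial m 1 : MvPolynomial (Fin n) ℂ) ∈ M := by
  classical
  intro N
  induction N with
  | zero =>
    intro m hm hmi
    have h1 : m = Finsupp.single i₀ d := by
      have h2 : Finsupp.single i₀ d ≤ m := by rw [Finsupp.single_le_iff]; omega
      have h3 : (m - Finsupp.single i₀ d).degree + d = d := by
        conv_rhs => rw [← hm, ← tsub_add_cancel_of_le h2]
        rw [map_add, Finsupp.degree_single]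
      have h4 : m - Finsupp.single i₀ d = 0 := by
        rw [← Finsupp.degree_eq_zero_iff]; omega
      rw [← tsub_add_cancel_of_le h2, h4, zero_add]
    rwa [h1]
  | succ N ih =>
    intro m hm hmi
    obtain ⟨j, hj, hmj⟩ : ∃ j, j ≠ i₀ ∧ m j ≠ 0 := by
      by_contra! hcon
      have : m = Finsupp.single i₀ (m i₀) := by
        ext i
        by_cases hi : i = i₀
        · subst hi; simp
        · rw [hcon i hi, Finsupp.single_eq_of_ne hi]
      rw [this, Finsupp.degree_single] at hm
      omega
    have h1 : Finsupp.single j 1 ≤ m := by rw [Finsupp.single_le_iff]; omega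
    obtain ⟨c, rfl⟩ : ∃ c, m = c + Finsupp.single j 1 := ⟨_, (tsub_add_cancel_of_le h1).symm⟩
    have hc : (c + Finsupp.single j 1 : Fin n →₀ ℕ) i₀ = c i₀ := by
      rw [Finsupp.add_apply, Finsupp.single_eq_of_ne hj.symm, add_zero]
    rw [hc] at hmi
    have h2 := ih (c + Finsupp.single i₀ 1) (by
      rw [map_add, Finsupp.degree_single] at hm ⊢; exact hm) (by
      rw [Finsupp.add_apply, Finsupp.single_eq_same]; omega)
    have h3 := hM i₀ j hj.symm _ h2
    rw [pderiv_monomial, add_tsub_cancel_right, X, monomial_mul, one_mul, one_mul, add_comm,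
      Finsupp.add_apply, Finsupp.single_eq_same] at h3
    have h4 : (monomial (c + Finsupp.single j 1) ((c i₀ + 1 : ℕ) : ℂ) : MvPolynomial (Fin n) ℂ) =
        ((c i₀ + 1 : ℕ) : ℂ) • monomial (c + Finsupp.single j 1) 1 := by
      rw [smul_monomial, smul_eq_mul, mul_one]
    rw [h4] at h3
    exact (Submodule.smul_mem_iff _ (Nat.cast_ne_zero.2 (Nat.succ_ne_zero (c i₀)))).1 h3

/-- The space of forms is irreducible under shears. -/
theorem eq_bot_or_eq_top_of_shear (i₀ : Fin n) (U : Submodule ℂ (Forms d n))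
    (hU : ∀ i j, i ≠ j → ∀ t, U.map (shearForms d i j t) ≤ U) : U = ⊥ ∨ U = ⊤ := by
  by_cases hbot : U = ⊥
  · exact Or.inl hbot
  right
  set M := U.map (Forms d n).subtype with hMdef
  have hM : ∀ i j, i ≠ j → ∀ p ∈ M, X j * pderiv i p ∈ M := by
    intro i j hij p hp
    refine X_mul_pderiv_mem (fun t p hp => ?_) hp
    obtain ⟨u, hu, rfl⟩ := hp
    exact ⟨_, hU i j hij t ⟨u, hu, rfl⟩, rfl⟩
  have hhom : ∀ p ∈ M, p.IsHomogeneous d := by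
    rintro _ ⟨u, -, rfl⟩
    exact u.2
  have hne : M ≠ ⊥ := by
    intro h
    apply hbot
    rw [eq_bot_iff]
    intro u hu
    have h1 : (u : MvPolynomial (Fin n) ℂ) ∈ M := ⟨u, hu, rfl⟩
    rw [h, Submodule.mem_bot] at h1
    exact (Submodule.mem_bot ℂ).2 (Subtype.ext h1)
  have h0 := exists_monomial_mem i₀ hhom hM hne
  rw [eq_top_iff]
  rintro p -
  have hp : (p : MvPolynomial (Fin n) ℂ) ∈ M := by
    rw [(p : MvPolynomial (Fin n) ℂ).as_sum]
    refine Submodule.sum_mem _ fun m hm => ?_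
    have hmd : m.degree = d := by
      by_contra h
      exact (mem_support_iff.1 hm) (((mem_homogeneousSubmodule _ _).1 p.2).coeff_eq_zero h)
    have hle : m i₀ ≤ d := hmd ▸ Finsupp.le_degree i₀ m
    have h1 := monomial_mem i₀ hM h0 (d - m i₀) m hmd (by omega)
    have h2 := Submodule.smul_mem M (coeff m (p : MvPolynomial (Fin n) ℂ)) h1
    rwa [smul_monomial, smul_eq_mul, mul_one] at h2
  obtain ⟨u, hu, hup⟩ := hp
  rwa [← Subtype.ext hup]

end Shears

end GaussianMoments
namespace GaussianMoments

open MvPolynomial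

/-! ### Quadratic forms as sums of squares -/

section Quadratic

variable {n r : ℕ}

/-- Diagonalize the bilinear form in an orthogonal basis. The number of nonzero diagonal entries is
at most the rank, and each of them has a square root in ℂ. -/
theorem exists_sum_mul_eq_of_isSymm {A : Matrix (Fin n) (Fin n) ℂ} (hA : A.IsSymm)
    (hr : A.rank ≤ r) : ∃ K : Fin r → Fin n → ℂ, ∀ i j, A i j = ∑ a, K a i * K a j := by
  classical
  let B : LinearMap.BilinForm ℂ (Fin n → ℂ) := Matrix.toBilin' A
  have hBapp : ∀ x y, B x y = x ⬝ᵥ A.mulVec y := fun x y => by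
    rw [Matrix.toBilin'_apply']
  have hB : LinearMap.IsSymm B := by
    refine ⟨fun x y => ?_⟩
    rw [RingHom.id_apply, hBapp, hBapp, Matrix.dotProduct_mulVec, ← Matrix.mulVec_transpose, hA.eq,
      dotProduct_comm]
  have : Invertible (2 : ℂ) := invertibleOfNonzero two_ne_zero
  obtain ⟨v, hv⟩ := LinearMap.BilinForm.exists_orthogonal_basis hB
  have hv' : ∀ k l, k ≠ l → B (v k) (v l) = 0 := fun k l h => hv h
  have hAij : ∀ i j, A i j = ∑ k, v.repr (Pi.single i 1) k * v.repr (Pi.single j 1) k *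
      B (v k) (v k) := by
    intro i j
    have h1 : A i j = B (Pi.single i 1) (Pi.single j 1) := by
      rw [Matrix.toBilin'_single]
    rw [h1]
    conv_lhs => rw [← v.sum_repr (Pi.single i 1), ← v.sum_repr (Pi.single j 1)]
    simp only [map_sum, LinearMap.sum_apply, map_smul, LinearMap.smul_apply, smul_eq_mul]
    refine Finset.sum_congr rfl fun k _ => ?_
    rw [Finset.sum_eq_single k]
    · ring
    · intro l _ hl
      rw [hv' l k hl, mul_zero]
    · simp
  let s := {k // B (v k) (v k) ≠ 0}
  have hcard : Fintype.card s ≤ Fintype.card (Fin r) := by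
    -- Pairing with v_l isolates the l-th coefficient of a relation, and B(v_l, v_l) ≠ 0.
    have hli : LinearIndependent ℂ fun k : s =>
        (⟨A.mulVec (v k), v k, rfl⟩ : LinearMap.range A.mulVecLin) := by
      rw [Fintype.linearIndependent_iff]
      intro c hc l
      have h1 := congrArg (fun w : LinearMap.range A.mulVecLin => v l.1 ⬝ᵥ (w : Fin n → ℂ)) hc
      simp only [Submodule.coe_sum, Submodule.coe_smul, Submodule.coe_zero, dotProduct_zero,
        dotProduct_sum, dotProduct_smul, ← hBapp] at h1
      rw [Finset.sum_eq_single l] at h1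
      · exact (mul_eq_zero.1 h1).resolve_right l.2
      · intro k _ hk
        rw [hv' _ _ fun h => hk (Subtype.ext h.symm), smul_zero]
      · simp
    have h2 := hli.fintype_card_le_finrank
    rw [Fintype.card_fin]
    exact h2.trans hr
  obtain ⟨g⟩ := Function.Embedding.nonempty_of_card_le hcard
  choose z hz using fun k : s => IsAlgClosed.exists_pow_nat_eq (B (v k.1) (v k.1)) two_pos
  -- The squares that are not needed are taken to be zero.
  refine ⟨Function.extend g (fun k i => z k * v.repr (Pi.single i 1) k.1) 0, fun i j => ?_⟩
  rw [← Fintype.sum_of_injective g g.injective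
    (fun k : s => (z k * v.repr (Pi.single i 1) k.1) * (z k * v.repr (Pi.single j 1) k.1))]
  · rw [hAij]
    refine (Fintype.sum_of_injective Subtype.val Subtype.val_injective _ _ (fun k hk => ?_)
      fun k => ?_).symm
    · rw [not_not.1 fun h => hk ⟨⟨k, h⟩, rfl⟩, mul_zero]
    · linear_combination
        (v.repr (Pi.single i 1) k.1 * v.repr (Pi.single j 1) k.1) * hz k
  · intro a ha
    rw [Function.extend_apply' _ _ _ (by simpa using ha)]
    simp
  · intro k
    rw [g.injective.extend_apply]

theorem quadraticFormOf_eq_sum {A : Matrix (Fin n) (Fin n) ℂ} {K : Fin r → Fin n → ℂ}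
    (h : ∀ i j, A i j = ∑ a, K a i * K a j) : quadraticFormOf A = ∑ a, linForm (K a) ^ 2 := by
  simp only [quadraticFormOf, h, linForm, sq, Finset.sum_mul_sum, map_sum]
  rw [Finset.sum_comm (s := (Finset.univ : Finset (Fin r)))]
  refine Finset.sum_congr rfl fun i _ => ?_
  rw [Finset.sum_comm (s := (Finset.univ : Finset (Fin r)))]
  refine Finset.sum_congr rfl fun j _ => ?_
  rw [Finset.sum_mul, Finset.sum_mul]
  refine Finset.sum_congr rfl fun a _ => ?_
  rw [map_mul]
  ring

theorem quadRankLE_iff {q : Forms 2 n} :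
    QuadRankLE q r ↔ ∃ K : Fin r → Fin n → ℂ, (q : MvPolynomial (Fin n) ℂ) =
      ∑ a, linForm (K a) ^ 2 := by
  constructor
  · rintro ⟨A, hA, hq, hr⟩
    obtain ⟨K, hK⟩ := exists_sum_mul_eq_of_isSymm hA hr
    exact ⟨K, hq.trans (quadraticFormOf_eq_sum hK)⟩
  · rintro ⟨K, hK⟩
    have h : ∀ i j, ((Matrix.of K).transpose * Matrix.of K) i j = ∑ a, K a i * K a j := fun i j => by
      simp [Matrix.mul_apply]
    refine ⟨(Matrix.of K).transpose * Matrix.of K, ?_, ?_, ?_⟩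
    · ext i j
      rw [Matrix.transpose_apply, h, h]
      exact Finset.sum_congr rfl fun a _ => mul_comm _ _
    · rw [hK, quadraticFormOf_eq_sum h]
    · refine (Matrix.rank_mul_le_right _ _).trans ?_
      simpa using Matrix.rank_le_card_height (Matrix.of K)

theorem exists_eq_linForm (l : Forms 1 n) :
    ∃ c : Fin n → ℂ, (l : MvPolynomial (Fin n) ℂ) = linForm c := by
  classical
  refine ⟨fun i => coeff (Finsupp.single i 1) (l : MvPolynomial (Fin n) ℂ), ?_⟩
  refine forms_ext (isHomogeneous_linForm _) fun b => ?_
  obtain ⟨i, hi⟩ : b.1 ∈ Set.range fun a : Fin n => Finsupp.single a 1 := by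
    rw [Finsupp.range_single_one]
    exact mem_exponents.1 b.2
  rw [← hi, linForm, coeff_sum, Finset.sum_eq_single i]
  · rw [coeff_C_mul, coeff_X_same, mul_one] 
  · intro j _ hj
    rw [coeff_C_mul, coeff_X, if_neg, mul_zero]
    intro h
    exact hj (Finsupp.single_left_injective one_ne_zero h)
  · simp

theorem gaussianMomentVariety_eq (d : ℕ) :
    gaussianMomentVariety d r n =
      zariskiClosure (Set.range (polyMap (formsBasis d n) (momentCoords n r d))) := by
  rw [gaussianMomentVariety]
  congr 1
  ext f
  constructor
  · rintro ⟨l, q, hq, rfl⟩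
    obtain ⟨c, hc⟩ := exists_eq_linForm l
    obtain ⟨K, hK⟩ := quadRankLE_iff.1 hq
    refine ⟨fun p => p.1.elim (c p.2) fun a => K a p.2, ?_⟩
    apply Subtype.ext
    rw [coe_polyMap_momentCoords, coe_gaussianMoment, hc, hK]
    rfl
  · rintro ⟨x, rfl⟩
    refine ⟨⟨linForm fun i => x (none, i), isHomogeneous_linForm _⟩,
      ⟨sumSquares x, isHomogeneous_sumSquares x⟩,
      quadRankLE_iff.2 ⟨fun a i => x (some a, i), rfl⟩, ?_⟩
    apply Subtype.ext
    rw [coe_polyMap_momentCoords, coe_gaussianMoment]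
    rfl

end Quadratic

/-! ### Linear changes of coordinates acting on the parametrization -/

section Equivariance

variable {n r : ℕ}

theorem shear_linForm {i j : Fin n} (t : ℂ) (c : Fin n → ℂ) :
    shear i j t (linForm c) = linForm fun k => c k + if k = j then t * c i else 0 := by
  have hC : ∀ a, shear i j t (C a) = C a := fun a => algHom_C _ a
  have hX : ∀ k, shear i j t (X k) = X k + if k = i then C t * X j else 0 := fun k => aeval_X _ k
  simp only [linForm, map_sum, map_mul, hC, hX, mul_add, Finset.sum_add_distrib, map_add, add_mul]
  congr 1
  rw [Finset.sum_eq_single i, Finset.sum_eq_single j]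
  · rw [if_pos rfl, if_pos rfl, map_mul]
    ring
  · intro k _ hk; rw [if_neg hk, map_zero, zero_mul]
  · simp
  · intro k _ hk; rw [if_neg hk, mul_zero]
  · simp

theorem shear_momentForm {i j : Fin n} (t : ℂ) (x : Option (Fin r) × Fin n → ℂ) (d : ℕ) :
    shear i j t (momentForm x d) =
      momentForm (fun p => x p + if p.2 = j then t * x (p.1, i) else 0) d := by
  rw [momentForm, map_expPart, shear_linForm, momentForm]
  congr 1
  simp only [sumSquares, map_sum, map_pow, shear_linForm]

theorem mem_tangentSpace_of_coe_eq {d : ℕ} {x : Option (Fin r) × Fin n → ℂ} (h : Fin n → ℂ)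
    (f : Forms (d + 1) n) (hf : (f : MvPolynomial (Fin n) ℂ) = linForm h * momentForm x (d + 1)) :
    f ∈ tangentSpace (formsBasis (d + 1) n) (momentCoords n r (d + 1)) x := by
  have : f = ∑ i, h i •
      tangentVector (formsBasis (d + 1) n) (momentCoords n r (d + 1)) x (none, i) := by
    apply Subtype.ext
    rw [hf, linForm, Finset.sum_mul, Submodule.coe_sum]
    refine Finset.sum_congr rfl fun i _ => ?_
    rw [Submodule.coe_smul, coe_tangentVector_none, smul_eq_C_mul, mul_assoc]
  rw [this]
  exact Submodule.sum_mem _ fun i _ => Submodule.smul_mem _ _ (Submodule.subset_span ⟨_, rfl⟩)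

theorem mem_tangentSpace_of_coe_eq_some {d : ℕ} {x : Option (Fin r) × Fin n → ℂ} (a : Fin r)
    (h : Fin n → ℂ) (f : Forms (d + 1) n)
    (hf : (f : MvPolynomial (Fin n) ℂ) =
      linForm (fun i => x (some a, i)) * linForm h * momentForm x d) :
    f ∈ tangentSpace (formsBasis (d + 1) n) (momentCoords n r (d + 1)) x := by
  have : f = ∑ i, h i •
      tangentVector (formsBasis (d + 1) n) (momentCoords n r (d + 1)) x (some a, i) := by
    apply Subtype.ext
    rw [hf, linForm, linForm, Finset.mul_sum, Finset.sum_mul, Submodule.coe_sum]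
    refine Finset.sum_congr rfl fun i _ => ?_
    rw [Submodule.coe_smul, coe_tangentVector_some, smul_eq_C_mul, linForm]
    ring
  rw [this]
  exact Submodule.sum_mem _ fun i _ => Submodule.smul_mem _ _ (Submodule.subset_span ⟨_, rfl⟩)

theorem X_eq_linForm (i : Fin n) : (X i : MvPolynomial (Fin n) ℂ) = linForm (Pi.single i 1) := by
  rw [linForm, Finset.sum_eq_single i]
  · simp
  · intro j _ hj
    rw [Pi.single_eq_of_ne hj, map_zero, zero_mul]
  · simp

/-- The symmetries of the parametrization act irreducibly on the space of forms. -/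
theorem moment_irreducible (i₀ : Fin n) (d : ℕ) (U : Submodule ℂ (Forms (d + 1) n))
    (hU : ∀ (Γ : Option (Fin r) × Fin n → MvPolynomial (Option (Fin r) × Fin n) ℂ)
      (τ : Forms (d + 1) n →ₗ[ℂ] Forms (d + 1) n),
      (Function.Surjective fun (x : Option (Fin r) × Fin n → ℂ) i => eval x (Γ i)) →
      (∀ x, (tangentSpace (formsBasis (d + 1) n) (momentCoords n r (d + 1))
        fun i => eval x (Γ i)).map τ ≤
          tangentSpace (formsBasis (d + 1) n) (momentCoords n r (d + 1)) x) →
      U.map τ ≤ U) : U = ⊥ ∨ U = ⊤ := by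
  refine eq_bot_or_eq_top_of_shear i₀ U fun i j hij t => ?_
  -- The inverse shear on the parameters: shearing the forms by t then carries the tangent space at
  -- Γ(x) into the one at x. That -t gives the inverse uses `i ≠ j`.
  let Γ : Option (Fin r) × Fin n → MvPolynomial (Option (Fin r) × Fin n) ℂ :=
    fun p => X p + if p.2 = j then C (-t) * X (p.1, i) else 0
  have hΓ : ∀ (x : Option (Fin r) × Fin n → ℂ) p,
      eval x (Γ p) = x p + if p.2 = j then -t * x (p.1, i) else 0 := by
    intro x p
    simp only [Γ, map_add, eval_X]
    split_ifs <;> simp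
  have hinv : ∀ (x : Option (Fin r) × Fin n → ℂ) p, eval x (Γ p) +
      (if p.2 = j then t * eval x (Γ (p.1, i)) else 0) = x p := by
    intro x p
    rw [hΓ, hΓ, if_neg hij]
    split_ifs <;> ring
  have hlin : ∀ (x : Option (Fin r) × Fin n → ℂ) o,
      shear i j t (linForm fun k => eval x (Γ (o, k))) = linForm fun k => x (o, k) := by
    intro x o
    rw [shear_linForm]
    congr 1
    funext k
    exact hinv x (o, k)
  have hmom : ∀ (x : Option (Fin r) × Fin n → ℂ) e,
      shear i j t (momentForm (fun p => eval x (Γ p)) e) = momentForm x e := by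
    intro x e
    rw [shear_momentForm]
    congr 1
    funext p
    exact hinv x p
  refine hU Γ (shearForms (d + 1) i j t) ?_ ?_
  · intro y
    refine ⟨fun p => y p + if p.2 = j then t * y (p.1, i) else 0, ?_⟩
    funext p
    simp only [hΓ, if_neg hij]
    split_ifs <;> ring
  · intro x
    rw [tangentSpace, Submodule.map_span, Submodule.span_le]
    rintro _ ⟨_, ⟨⟨o, k⟩, rfl⟩, rfl⟩
    cases o with
    | none =>
      refine mem_tangentSpace_of_coe_eq
        (fun k' => (Pi.single k 1 : Fin n → ℂ) k' + if k' = j then t * (Pi.single k 1 : Fin n → ℂ) i else 0) _ ?_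
      change shear i j t ((tangentVector _ _ _ _ : Forms (d + 1) n) : MvPolynomial (Fin n) ℂ) = _
      rw [coe_tangentVector_none, map_mul, hmom, X_eq_linForm, shear_linForm]
    | some a =>
      refine mem_tangentSpace_of_coe_eq_some a
        (fun k' => (Pi.single k 1 : Fin n → ℂ) k' + if k' = j then t * (Pi.single k 1 : Fin n → ℂ) i else 0) _ ?_
      change shear i j t ((tangentVector _ _ _ _ : Forms (d + 1) n) : MvPolynomial (Fin n) ℂ) = _
      rw [coe_tangentVector_some, map_mul, map_mul, hmom, X_eq_linForm, hlin, shear_linForm]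

end Equivariance

end GaussianMoments
namespace GaussianMoments

open MvPolynomial

/-! ### Upper bound for the dimension -/

section UpperBound

variable {n r : ℕ}

variable (n) in
/-- The space of linear forms. -/
noncomputable abbrev linearForms : Submodule ℂ (MvPolynomial (Fin n) ℂ) :=
  Submodule.span ℂ (Set.range X)

theorem linearIndependent_X : LinearIndependent ℂ (X : Fin n → MvPolynomial (Fin n) ℂ) :=
  (basisMonomials (Fin n) ℂ).linearIndependent.comp (fun i => Finsupp.single i 1)
    (Finsupp.single_left_injective one_ne_zero)

theorem finrank_linearForms : Module.finrank ℂ (linearForms n) = n := by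
  rw [finrank_span_eq_card linearIndependent_X, Fintype.card_fin]

theorem linForm_mem_linearForms (c : Fin n → ℂ) : linForm c ∈ linearForms n := by
  refine Submodule.sum_mem _ fun i _ => ?_
  rw [← smul_eq_C_mul]
  exact Submodule.smul_mem _ _ (Submodule.subset_span ⟨i, rfl⟩)

theorem finiteDimensional_mul {A : Type*} [CommRing A] [Algebra ℂ A] (K L : Submodule ℂ A)
    [FiniteDimensional ℂ K] [FiniteDimensional ℂ L] : FiniteDimensional ℂ (K * L : Submodule ℂ A) :=
  Module.Finite.iff_fg.2 ((Module.Finite.iff_fg.1 ‹_›).mul (Module.Finite.iff_fg.1 ‹_›))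

theorem finrank_map_mulLeft {A : Type*} [CommRing A] [IsDomain A] [Algebra ℂ A] {v : A}
    (hv : v ≠ 0) (L : Submodule ℂ A) :
    Module.finrank ℂ (L.map (LinearMap.mulLeft ℂ v)) = Module.finrank ℂ L :=
  (Submodule.equivMapOfInjective _ (fun _ _ h => mul_left_cancel₀ hv h) L).finrank_eq.symm

/-- When k_0 is added to the span K of s independent elements, the new piece k_0 L meets K L at
least in k_0 K, because k_0 and K lie in L. So the dimension grows by at most dim L - s; these
losses add up to the binomial coefficient in M_r. -/
theorem finrank_span_mul_le {A : Type*} [CommRing A] [IsDomain A] [Algebra ℂ A]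
    (L : Submodule ℂ A) [FiniteDimensional ℂ L] (s : ℕ) :
    ∀ k : Fin s → A, LinearIndependent ℂ k → (∀ a, k a ∈ L) →
      Module.finrank ℂ (Submodule.span ℂ (Set.range k) * L : Submodule ℂ A) ≤
        ∑ a ∈ Finset.range s, (Module.finrank ℂ L - a) := by
  induction s with
  | zero =>
    intro k _ _
    rw [Set.range_eq_empty, Submodule.span_empty, Submodule.bot_mul, finrank_bot]
    exact Nat.zero_le _
  | succ s ih =>
    intro k hk hL
    rw [linearIndependent_finSucc] at hk
    set K := Submodule.span ℂ (Set.range (Fin.tail k))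
    have hv : k 0 ≠ 0 := fun h => hk.2 (h ▸ Submodule.zero_mem _)
    have hfin : FiniteDimensional ℂ K := FiniteDimensional.span_of_finite ℂ (Set.finite_range _)
    have := finiteDimensional_mul K L
    have hKL : K ≤ L := by
      rw [Submodule.span_le]
      rintro _ ⟨a, rfl⟩
      exact hL a.succ
    have hsup : Submodule.span ℂ (Set.range k) * L = K * L ⊔ L.map (LinearMap.mulLeft ℂ (k 0)) := by
      have h1 : Set.range k = insert (k 0) (Set.range (Fin.tail k)) := by
        rw [← Fin.range_cons, Fin.cons_self_tail]
      rw [h1, Submodule.span_insert, Submodule.sup_mul, sup_comm, Submodule.span_singleton_mul]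
      rfl
    have hinf : K.map (LinearMap.mulLeft ℂ (k 0)) ≤ K * L ⊓ L.map (LinearMap.mulLeft ℂ (k 0)) := by
      refine le_inf ?_ (Submodule.map_mono hKL)
      rintro _ ⟨u, hu, rfl⟩
      rw [LinearMap.mulLeft_apply, mul_comm (k 0)]
      exact Submodule.mul_mem_mul hu (hL 0)
    have h1 := Submodule.finrank_sup_add_finrank_inf_eq (K * L) (L.map (LinearMap.mulLeft ℂ (k 0)))
    have h2 := Submodule.finrank_mono hinf
    rw [finrank_map_mulLeft hv, finrank_span_eq_card hk.1, Fintype.card_fin] at h2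
    rw [finrank_map_mulLeft hv, ← hsup] at h1
    have h3 := ih _ hk.1 fun a => hL a.succ
    rw [Finset.sum_range_succ]
    change Module.finrank ℂ (K * L : Submodule ℂ A) ≤ _ at h3
    omega

theorem finrank_mul_le {A : Type*} [CommRing A] [IsDomain A] [Algebra ℂ A]
    {K L : Submodule ℂ A} [FiniteDimensional ℂ L] (hKL : K ≤ L) :
    Module.finrank ℂ (K * L : Submodule ℂ A) ≤
      ∑ a ∈ Finset.range (Module.finrank ℂ K), (Module.finrank ℂ L - a) := by
  have := Submodule.finiteDimensional_of_le hKL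
  let b := Module.finBasis ℂ K
  have h := finrank_span_mul_le L _ (fun a => (b a : A))
    (b.linearIndependent.map' K.subtype K.ker_subtype) fun a => hKL (b a).2
  have hspan : Submodule.span ℂ (Set.range fun a => (b a : A)) = K := by
    have : (Set.range fun a => (b a : A)) = K.subtype '' Set.range b := by
      rw [← Set.range_comp]; rfl
    rw [this, ← Submodule.map_span, b.span_eq, Submodule.map_subtype_top]
  rwa [hspan] at h

theorem coe_mem_of_mem_tangentSpace {d : ℕ} (x : Option (Fin r) × Fin n → ℂ) :
    (tangentSpace (formsBasis (d + 1) n) (momentCoords n r (d + 1)) x).map (Forms (d + 1) n).subtype ≤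
      (linearForms n).map (LinearMap.mulLeft ℂ (momentForm x (d + 1))) ⊔
      (Submodule.span ℂ (Set.range fun a => linForm fun i => x (some a, i)) * linearForms n).map
        (LinearMap.mulLeft ℂ (momentForm x d)) := by
  rw [tangentSpace, Submodule.map_span, Submodule.span_le]
  rintro _ ⟨_, ⟨⟨o, i⟩, rfl⟩, rfl⟩
  have hX : (X i : MvPolynomial (Fin n) ℂ) ∈ linearForms n := Submodule.subset_span ⟨i, rfl⟩
  rw [Submodule.subtype_apply]
  cases o with
  | none =>
    refine Submodule.mem_sup_left ⟨_, hX, ?_⟩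
    rw [coe_tangentVector_none, LinearMap.mulLeft_apply, mul_comm]
  | some a =>
    refine Submodule.mem_sup_right
      ⟨_, Submodule.mul_mem_mul (Submodule.subset_span ⟨a, rfl⟩) hX, ?_⟩
    rw [coe_tangentVector_some, LinearMap.mulLeft_apply, mul_comm]

theorem finrank_tangentSpace_le {d : ℕ} (x : Option (Fin r) × Fin n → ℂ) :
    Module.finrank ℂ (tangentSpace (formsBasis (d + 1) n) (momentCoords n r (d + 1)) x) ≤
      n + ∑ a ∈ Finset.range r, (n - a) := by
  set k : Fin r → MvPolynomial (Fin n) ℂ := fun a => linForm fun i => x (some a, i)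
  set K := Submodule.span ℂ (Set.range k) with hK
  have hKL : K ≤ linearForms n := by
    rw [Submodule.span_le]
    rintro _ ⟨a, rfl⟩
    exact linForm_mem_linearForms _
  have hfin : FiniteDimensional ℂ (linearForms n) :=
    FiniteDimensional.span_of_finite ℂ (Set.finite_range _)
  have hfin' : FiniteDimensional ℂ K := Submodule.finiteDimensional_of_le hKL
  have := finiteDimensional_mul K (linearForms n)
  have hKr : Module.finrank ℂ K ≤ r := (finrank_range_le_card k).trans_eq (Fintype.card_fin r)
  rw [← Submodule.finrank_map_subtype_eq]
  refine (Submodule.finrank_mono (coe_mem_of_mem_tangentSpace x)).trans ?_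
  refine (Submodule.finrank_add_le_finrank_add_finrank _ _).trans (add_le_add ?_ ?_)
  · exact (Submodule.finrank_map_le _ _).trans_eq finrank_linearForms
  · refine (Submodule.finrank_map_le _ _).trans ((finrank_mul_le hKL).trans ?_)
    rw [finrank_linearForms]
    exact Finset.sum_le_sum_of_subset (Finset.range_subset_range.2 hKr)

theorem secantRank_one_le (d : ℕ) :
    secantRank (momentCoords n r (d + 1)) 1 ≤ n + ∑ a ∈ Finset.range r, (n - a) := by
  obtain ⟨x, hx⟩ := (eventually_finrank_tangentSum (formsBasis (d + 1) n)
    (momentCoords n r (d + 1)) (id : Fin 1 → Fin 1) Function.injective_id).exists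
  rw [Fintype.card_fin, tangentSum, iSup_unique] at hx
  rw [← hx]
  exact finrank_tangentSpace_le _

theorem finrank_tangentSpace_le_secantRank_one (d : ℕ) (x : Option (Fin r) × Fin n → ℂ) :
    Module.finrank ℂ (tangentSpace (formsBasis (d + 1) n) (momentCoords n r (d + 1)) x) ≤
      secantRank (momentCoords n r (d + 1)) 1 := by
  have h := finrank_tangentSum_le (formsBasis (d + 1) n) (momentCoords n r (d + 1))
    (id : Fin 1 → Fin 1) fun p => x p.2
  rwa [Fintype.card_fin, tangentSum, iSup_unique] at h

end UpperBound

end GaussianMoments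
namespace GaussianMoments

open MvPolynomial

/-! ### Coprimality of consecutive parts -/

section Coprime

variable {B : Type*} [CommRing B] [Algebra ℂ B] [DecompositionMonoid B]

/-- By the recurrence, a common divisor of q and the next part divides l times the present part.
Being prime to l, it divides the present part, and one descends. -/
theorem isRelPrime_expPart {l q : B} (h : IsRelPrime l q) (d : ℕ) :
    IsRelPrime (expPart l q (d + 1)) q := by
  induction d with
  | zero => exact isRelPrime_one_left
  | succ d ih =>
    intro x hx hxq
    have h1 : x ∣ l * expPart l q (d + 1) := by
      have h2 : x ∣ l * expPart l q (d + 1) + q * expPart l q d := by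
        rw [← smul_expPart_add_two, Algebra.smul_def]
        exact hx.mul_left _
      exact (dvd_add_left (hxq.mul_right _)).1 h2
    exact ih ((h.symm.of_dvd_left hxq).dvd_of_dvd_mul_left h1) hxq

/-- A common divisor of two consecutive parts divides q times the preceding part. It is prime to q
by `isRelPrime_expPart`, so it divides the preceding part. -/
theorem isRelPrime_expPart_succ {l q : B} (h : IsRelPrime l q) (d : ℕ) :
    IsRelPrime (expPart l q (d + 1)) (expPart l q d) := by
  induction d with
  | zero => exact isRelPrime_one_left
  | succ d ih =>
    intro x hx hx'
    have h1 : x ∣ q * expPart l q d := by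
      have h2 : x ∣ l * expPart l q (d + 1) + q * expPart l q d := by
        rw [← smul_expPart_add_two, Algebra.smul_def]
        exact hx.mul_left _
      exact (dvd_add_right (hx'.mul_left _)).1 h2
    exact ih hx' (((isRelPrime_expPart h d).of_dvd_left hx').dvd_of_dvd_mul_left h1)

end Coprime

/-! ### The tangent space at a standard point, and the exceptional cases -/

section StandardPoint

variable {n r : ℕ}

/-- The parameters for which the linear form is the variable `X z`, and the quadratic form is the
sum of the squares of the first `r` variables. -/
noncomputable def standardPoint (hr : r ≤ n) (z : Fin n) : Option (Fin r) × Fin n → ℂ :=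
  fun p => (Pi.single (p.1.elim z (Fin.castLE hr)) 1 : Fin n → ℂ) p.2

theorem linForm_standardPoint (hr : r ≤ n) (z : Fin n) (o : Option (Fin r)) :
    (linForm fun i => standardPoint hr z (o, i)) = X (o.elim z (Fin.castLE hr)) := by
  rw [X_eq_linForm]
  simp only [standardPoint]

theorem sumSquares_standardPoint (hr : r ≤ n) (z : Fin n) :
    sumSquares (standardPoint hr z) = ∑ a : Fin r, X (Fin.castLE hr a) ^ 2 := by
  simp only [sumSquares, linForm_standardPoint, Option.elim_some]

theorem momentForm_standardPoint (hr : r ≤ n) (z : Fin n) (d : ℕ) :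
    momentForm (standardPoint hr z) d = expPart (X z) (∑ a : Fin r, X (Fin.castLE hr a) ^ 2) d := by
  rw [momentForm, linForm_standardPoint, sumSquares_standardPoint, Option.elim_none]

/-- The coefficients of the recurrence are positive, so no cancellation can occur. This gives the
nonvanishing of the moment forms at a coordinate vector. -/
theorem exists_pos_expPart_eq {c : ℝ} (hc : 0 ≤ c) (d : ℕ) :
    ∃ p : ℝ, 0 < p ∧ expPart (1 : ℂ) (c : ℂ) (d + 1) = p := by
  induction d using Nat.twoStepInduction with
  | zero => exact ⟨1, one_pos, by simp [expPart]⟩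
  | one => exact ⟨1, one_pos, by simp [expPart]⟩
  | more d h1 h2 =>
    obtain ⟨p, hp, h1⟩ := h1
    obtain ⟨p', hp', h2⟩ := h2
    refine ⟨(((d + 1 : ℕ) : ℝ) + 1)⁻¹ * (p' + c * p), by positivity, ?_⟩
    rw [expPart_add_two, h1, h2, smul_eq_mul]
    push_cast
    ring

theorem eval_momentForm_standardPoint_ne_zero (hr : r ≤ n) (z : Fin n) (d : ℕ) :
    eval (Pi.single z 1) (momentForm (standardPoint hr z) (d + 1)) ≠ 0 := by
  rw [momentForm_standardPoint]
  have h := map_expPart (aeval (Pi.single z 1 : Fin n → ℂ)) (X z : MvPolynomial (Fin n) ℂ)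
    (∑ a : Fin r, X (Fin.castLE hr a) ^ 2) (d + 1)
  simp only [aeval_X, map_sum, map_pow, Pi.single_eq_same] at h
  have hc : ∑ a : Fin r, (Pi.single z 1 : Fin n → ℂ) (Fin.castLE hr a) ^ 2 =
      ((∑ a : Fin r, (Pi.single z 1 : Fin n → ℝ) (Fin.castLE hr a) ^ 2 : ℝ) : ℂ) := by
    push_cast
    refine Finset.sum_congr rfl fun a _ => ?_
    simp only [Pi.single_apply]
    split_ifs <;> simp
  rw [hc] at h
  obtain ⟨p, hp, hp'⟩ := exists_pos_expPart_eq
    (Finset.sum_nonneg fun a _ => sq_nonneg ((Pi.single z 1 : Fin n → ℝ) (Fin.castLE hr a))) d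
  change aeval (Pi.single z 1 : Fin n → ℂ) _ ≠ (0 : ℂ)
  rw [h, hp']
  exact_mod_cast hp.ne'

theorem momentForm_standardPoint_ne_zero (hr : r ≤ n) (z : Fin n) (d : ℕ) :
    momentForm (standardPoint hr z) (d + 1) ≠ 0 := fun h =>
  eval_momentForm_standardPoint_ne_zero hr z d (by rw [h, map_zero])

theorem isRelPrime_standardPoint (hr : r ≤ n) (hr1 : 1 ≤ r) {z : Fin n} (hz : (z : ℕ) ≠ 0) :
    IsRelPrime (X z : MvPolynomial (Fin n) ℂ) (∑ a : Fin r, X (Fin.castLE hr a) ^ 2) := by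
  rw [X_prime.irreducible.isRelPrime_iff_not_dvd]
  rintro ⟨g, hg⟩
  have h := congrArg (eval (Pi.single (Fin.castLE hr ⟨0, hr1⟩) 1 : Fin n → ℂ)) hg
  rw [map_mul, eval_X, Pi.single_eq_of_ne, zero_mul, map_sum, Finset.sum_eq_single ⟨0, hr1⟩] at h
  · simp at h
  · intro a _ ha
    rw [map_pow, eval_X, Pi.single_eq_of_ne, zero_pow two_ne_zero]
    exact fun h => ha (Fin.castLE_injective hr h)
  · simp
  · intro h
    exact hz (congrArg Fin.val h)

/-- The pairs of indices that parametrize the monomials divisible by one of the first `r`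
variables. -/
abbrev MonomialPairs (hr : r ≤ n) : Type := Σ a : Fin r, ↥(Finset.Ici (Fin.castLE hr a))

theorem card_monomialPairs (hr : r ≤ n) :
    Fintype.card (MonomialPairs hr) = ∑ a ∈ Finset.range r, (n - a) := by
  rw [Fintype.card_sigma, ← Fin.sum_univ_eq_sum_range (fun a => n - a)]
  refine Finset.sum_congr rfl fun a _ => ?_
  rw [Fintype.card_coe, Fin.card_Ici, Fin.val_castLE]

/-- The monomials of degree two divisible by one of the first `r` variables. -/
noncomputable def pairMonomial (hr : r ≤ n) (p : MonomialPairs hr) : MvPolynomial (Fin n) ℂ :=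
  X (Fin.castLE hr p.1) * X p.2.1

theorem linearIndependent_pairMonomial (hr : r ≤ n) : LinearIndependent ℂ (pairMonomial hr) := by
  have hinj : Function.Injective fun p : MonomialPairs hr =>
      Finsupp.single (Fin.castLE hr p.1) 1 + Finsupp.single p.2.1 1 := by
    rintro ⟨a, i, hi⟩ ⟨b, j, hj⟩ h
    rw [Finset.mem_Ici] at hi hj
    rcases (Finsupp.single_add_single_eq_single_add_single one_ne_zero one_ne_zero).1 h with
      ⟨h1, h2⟩ | ⟨-, h1, h2⟩ | ⟨h1, -, -⟩
    · obtain rfl := Fin.castLE_injective hr h1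
      obtain rfl : i = j := h2
      rfl
    · simp only at h1 h2
      have h3 : Fin.castLE hr a = Fin.castLE hr b :=
        le_antisymm (hi.trans_eq h2) (hj.trans_eq h1.symm)
      obtain rfl := Fin.castLE_injective hr h3
      obtain rfl : i = j := h2.trans h1
      rfl
    · omega
  have h := (basisMonomials (Fin n) ℂ).linearIndependent.comp _ hinj
  have heq : pairMonomial hr = basisMonomials (Fin n) ℂ ∘ fun p : MonomialPairs hr =>
      Finsupp.single (Fin.castLE hr p.1) 1 + Finsupp.single p.2.1 1 := by
    funext p
    rw [Function.comp_apply, coe_basisMonomials, pairMonomial, X, X, monomial_mul, one_mul]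
  rw [heq]
  exact h

/-- Write the relation as h s_d = p s_{d-1}. For r = 0, p is zero. Otherwise s_d and s_{d-1} are
coprime and s_d divides p, which has degree 2, so p = 0 if d ≥ 3. If d = 2, then s_1 = X_z divides
h, whence h = c X_z and p = c s_2. At the coordinate vector of z, s_2 does not vanish, but p does
since r < n keeps z out of the first r variables; so c = 0. -/
theorem eq_zero_of_mul_momentForm_eq (hr : r ≤ n) {z : Fin n} (hz : (z : ℕ) + 1 = n) {d : ℕ}
    (hd : r = 0 ∨ 2 ≤ n ∧ 1 ≤ r ∧ (3 ≤ d ∨ d = 2 ∧ r < n)) {h p : MvPolynomial (Fin n) ℂ}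
    (hh : h ∈ linearForms n) (hp : p ∈ Submodule.span ℂ (Set.range (pairMonomial hr)))
    (hhp : h * momentForm (standardPoint hr z) (d + 1) = p * momentForm (standardPoint hr z) d) :
    h = 0 := by
  have hE := momentForm_standardPoint_ne_zero hr z d
  rcases hd with rfl | ⟨hn, hr1, hd⟩
  · rw [Set.range_eq_empty, Submodule.span_empty, Submodule.mem_bot] at hp
    rw [hp, zero_mul] at hhp
    exact (mul_eq_zero.1 hhp).resolve_right hE
  have hrel : IsRelPrime (momentForm (standardPoint hr z) (d + 1))
      (momentForm (standardPoint hr z) d) := by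
    rw [momentForm_standardPoint, momentForm_standardPoint]
    exact isRelPrime_expPart_succ (isRelPrime_standardPoint hr hr1 (by omega)) d
  rcases hd with hd | ⟨rfl, hrn⟩
  · have hp2 : p.IsHomogeneous 2 := by
      refine (Submodule.span_le (p := homogeneousSubmodule (Fin n) ℂ 2)).2 ?_ hp
      rintro _ ⟨a, rfl⟩
      exact (isHomogeneous_X _ _).mul (isHomogeneous_X _ _)
    obtain ⟨g, hg⟩ := hrel.dvd_of_dvd_mul_right (Dvd.intro_left _ hhp)
    have hp0 : p = 0 := by
      by_contra hp0
      have h1 := hp2.totalDegree hp0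
      rw [hg] at hp0
      rw [hg, totalDegree_mul_of_isDomain hE (right_ne_zero_of_mul hp0),
        (isHomogeneous_momentForm _ d).totalDegree hE] at h1
      omega
    rw [hp0, zero_mul] at hhp
    exact (mul_eq_zero.1 hhp).resolve_right hE
  · have hl : momentForm (standardPoint hr z) 2 = X z := by
      rw [momentForm_standardPoint]
      simp [expPart]
    rw [hl] at hhp hrel
    obtain ⟨g, rfl⟩ := hrel.symm.dvd_of_dvd_mul_right (Dvd.intro_left _ hhp.symm)
    by_contra h0
    have hh1 : (X z * g).IsHomogeneous 1 := by
      refine (Submodule.span_le (p := homogeneousSubmodule (Fin n) ℂ 1)).2 ?_ hh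
      rintro _ ⟨a, rfl⟩
      exact isHomogeneous_X _ _
    have hg : g.totalDegree = 0 := by
      have h1 := hh1.totalDegree h0
      rw [totalDegree_mul_of_isDomain (X_ne_zero _) (right_ne_zero_of_mul h0), totalDegree_X] at h1
      omega
    rw [totalDegree_eq_zero_iff_eq_C] at hg
    have hpz : eval (Pi.single z 1) p = 0 := by
      refine (Submodule.span_le (p := LinearMap.ker (aeval (Pi.single z 1 : Fin n → ℂ)).toLinearMap)).2
        ?_ hp
      rintro _ ⟨a, rfl⟩
      rw [SetLike.mem_coe, LinearMap.mem_ker, AlgHom.toLinearMap_apply, pairMonomial, map_mul,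
        aeval_X, Pi.single_eq_of_ne, zero_mul]
      intro h
      have := congrArg Fin.val h
      have := a.1.2
      simp only [Fin.val_castLE] at *
      omega
    have hp' : g * momentForm (standardPoint hr z) 3 = p := by
      apply mul_right_cancel₀ (X_ne_zero (R := ℂ) z)
      rw [← hhp]
      ring
    rw [← hp', map_mul, hg, eval_C] at hpz
    have hc := (mul_eq_zero.1 hpz).resolve_right (eval_momentForm_standardPoint_ne_zero hr z 2)
    rw [hc, map_zero] at hg
    exact h0 (by rw [hg, mul_zero])

/-- The products X_i s_d and X_a X_i s_{d-1} with i ≥ a are tangent vectors. Each family is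
independent, and their spans meet trivially by `eq_zero_of_mul_momentForm_eq`. -/
theorem le_finrank_tangentSpace (hr : r ≤ n) {z : Fin n} (hz : (z : ℕ) + 1 = n) {d : ℕ}
    (hd : r = 0 ∨ 2 ≤ n ∧ 1 ≤ r ∧ (3 ≤ d ∨ d = 2 ∧ r < n)) :
    n + ∑ a ∈ Finset.range r, (n - a) ≤ Module.finrank ℂ
      (tangentSpace (formsBasis (d + 1) n) (momentCoords n r (d + 1)) (standardPoint hr z)) := by
  set x := standardPoint hr z with hx
  let T := (tangentSpace (formsBasis (d + 1) n) (momentCoords n r (d + 1)) x).map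
    (Forms (d + 1) n).subtype
  let v : Fin n → MvPolynomial (Fin n) ℂ := fun i => X i * momentForm x (d + 1)
  let w : MonomialPairs hr → MvPolynomial (Fin n) ℂ := fun p => pairMonomial hr p * momentForm x d
  have hE := momentForm_standardPoint_ne_zero hr z d
  have hv : LinearIndependent ℂ v :=
    linearIndependent_X.map' (LinearMap.mulRight ℂ (momentForm x (d + 1)))
      (LinearMap.ker_eq_bot.2 fun _ _ h => mul_right_cancel₀ hE h)
  have hw : LinearIndependent ℂ w := by
    rcases hd with rfl | ⟨-, -, hd⟩
    · exact linearIndependent_empty_type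
    · obtain ⟨d, rfl⟩ : ∃ d', d = d' + 1 := ⟨d - 1, by omega⟩
      exact (linearIndependent_pairMonomial hr).map' (LinearMap.mulRight ℂ (momentForm x (d + 1)))
        (LinearMap.ker_eq_bot.2 fun _ _ h =>
          mul_right_cancel₀ (momentForm_standardPoint_ne_zero hr z d) h)
  have hvs : Submodule.span ℂ (Set.range v) =
      (linearForms n).map (LinearMap.mulRight ℂ (momentForm x (d + 1))) := by
    rw [Submodule.map_span, ← Set.range_comp]; rfl
  have hws : Submodule.span ℂ (Set.range w) = (Submodule.span ℂ (Set.range (pairMonomial hr))).map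
      (LinearMap.mulRight ℂ (momentForm x d)) := by
    rw [Submodule.map_span, ← Set.range_comp]; rfl
  have hdisj : Disjoint (Submodule.span ℂ (Set.range v)) (Submodule.span ℂ (Set.range w)) := by
    rw [hvs, hws, Submodule.disjoint_def]
    rintro _ ⟨h, hh, rfl⟩ ⟨p, hp, hhp⟩
    rw [eq_zero_of_mul_momentForm_eq hr hz hd hh hp hhp.symm, map_zero]
  have hli := hv.sum_type hw hdisj
  have hle : Submodule.span ℂ (Set.range (Sum.elim v w)) ≤ T := by
    rw [Submodule.span_le]
    rintro _ ⟨i | p, rfl⟩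
    · refine ⟨_, Submodule.subset_span ⟨(none, i), rfl⟩, ?_⟩
      rw [Submodule.subtype_apply, coe_tangentVector_none]
      rfl
    · refine ⟨_, Submodule.subset_span ⟨(some p.1, p.2.1), rfl⟩, ?_⟩
      rw [Submodule.subtype_apply, coe_tangentVector_some, hx, linForm_standardPoint]
      rfl
  have hcard := finrank_span_eq_card hli
  rw [Fintype.card_sum, Fintype.card_fin, card_monomialPairs] at hcard
  rw [← hcard, ← Submodule.finrank_map_subtype_eq]
  exact Submodule.finrank_mono hle

theorem secantRank_one_eq (hn : 1 ≤ n) (hr : r ≤ n) {d : ℕ}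
    (hd : r = 0 ∨ 2 ≤ n ∧ 1 ≤ r ∧ (3 ≤ d ∨ d = 2 ∧ r < n)) :
    secantRank (momentCoords n r (d + 1)) 1 = n + ∑ a ∈ Finset.range r, (n - a) :=
  le_antisymm (secantRank_one_le d)
    ((le_finrank_tangentSpace hr (z := ⟨n - 1, by omega⟩) (by simp only; omega) hd).trans
      (finrank_tangentSpace_le_secantRank_one d _))

theorem one_le_secantRank_one (hn : 1 ≤ n) (hr : r ≤ n) (d : ℕ) :
    1 ≤ secantRank (momentCoords n r (d + 1)) 1 := by
  let z : Fin n := ⟨0, hn⟩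
  refine le_trans ?_ (finrank_tangentSpace_le_secantRank_one d (standardPoint hr z))
  rw [Nat.one_le_iff_ne_zero, Submodule.finrank_eq_zero.ne]
  intro h
  have h1 : tangentVector (formsBasis (d + 1) n) (momentCoords n r (d + 1))
      (standardPoint hr z) (none, z) ∈ (⊥ : Submodule ℂ (Forms (d + 1) n)) :=
    h ▸ Submodule.subset_span ⟨_, rfl⟩
  have h2 := congrArg Subtype.val ((Submodule.mem_bot ℂ).1 h1)
  rw [coe_tangentVector_none] at h2
  exact mul_ne_zero (X_ne_zero _) (momentForm_standardPoint_ne_zero hr z d) h2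

theorem exists_eq_add_single {m : Fin n →₀ ℕ} {d : ℕ} (hm : m.degree = d + 1) :
    ∃ m' i, m'.degree = d ∧ m = m' + Finsupp.single i 1 := by
  obtain ⟨i, hi⟩ : ∃ i, m i ≠ 0 := by
    by_contra! h
    rw [Finsupp.ext (g := 0) h, map_zero] at hm
    omega
  have h1 : Finsupp.single i 1 ≤ m := by
    rw [Finsupp.single_le_iff]; omega
  refine ⟨m - Finsupp.single i 1, i, ?_, (tsub_add_cancel_of_le h1).symm⟩
  rw [← tsub_add_cancel_of_le h1, map_add, Finsupp.degree_single] at hm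
  omega

theorem coe_formsBasis {d : ℕ} (b : Exponents d n) :
    (formsBasis d n b : MvPolynomial (Fin n) ℂ) = monomial b.1 1 := by
  refine forms_ext (isHomogeneous_monomial _ (mem_exponents.1 b.2)) fun c => ?_
  have h : formsBasis d n b = (formsBasis d n).equivFun.symm (Pi.single b 1) := by
    rw [LinearEquiv.eq_symm_apply]
    funext j
    rw [Module.Basis.equivFun_self, Pi.single_apply]
    exact if_congr eq_comm rfl rfl
  rw [h, coeff_formsBasis_equivFun_symm, coeff_monomial, Pi.single_apply]
  exact if_congr (by rw [Subtype.ext_iff, eq_comm]) rfl rfl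

theorem secantRank_eq_card_of_monomial_mem {d : ℕ} (x : Fin n → Option (Fin r) × Fin n → ℂ)
    (h : ∀ m : Fin n →₀ ℕ, m.degree = d + 1 → ∃ i, ∃ f ∈ tangentSpace (formsBasis (d + 1) n)
      (momentCoords n r (d + 1)) (x i), (f : MvPolynomial (Fin n) ℂ) = monomial m 1) :
    secantRank (momentCoords n r (d + 1)) n = Fintype.card (Exponents (d + 1) n) := by
  refine le_antisymm (secantRank_le (formsBasis (d + 1) n) _ n) ?_
  have h1 := finrank_tangentSum_le (formsBasis (d + 1) n) (momentCoords n r (d + 1))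
    (id : Fin n → Fin n) fun p => x p.1 p.2
  have htop : tangentSum (formsBasis (d + 1) n) (momentCoords n r (d + 1))
    (id : Fin n → Fin n) (fun p => x p.1 p.2) = ⊤ := by
    rw [eq_top_iff]
    rintro f -
    have hf : f = ∑ b : Exponents (d + 1) n,
        coeff b.1 (f : MvPolynomial (Fin n) ℂ) • formsBasis (d + 1) n b :=
      ((formsBasis (d + 1) n).sum_repr f).symm
    rw [hf]
    refine Submodule.sum_mem _ fun b _ => Submodule.smul_mem _ _ ?_
    obtain ⟨i, g, hg, hgm⟩ := h b.1 (mem_exponents.1 b.2)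
    have hgb : g = formsBasis (d + 1) n b :=
      Subtype.ext (hgm.trans (coe_formsBasis b).symm)
    rw [← hgb]
    exact Submodule.mem_iSup_of_mem i hg
  rwa [htop, finrank_top, Fintype.card_fin, Module.finrank_eq_card_basis (formsBasis (d + 1) n)]
    at h1

/-- With ℓ running through the n variables, every monomial occurs as a tangent vector: X_i in degree
1, X_i ℓ in degree 2, and X_i X_j ℓ in degree 3 when all variables are among the k_a. For n = 1 the
space of forms is a line. -/
theorem secantRank_eq_card (hn : 1 ≤ n) (hr : r ≤ n) {d : ℕ}
    (hd : n = 1 ∨ d ≤ 1 ∨ d = 2 ∧ r = n) :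
    secantRank (momentCoords n r (d + 1)) n = Fintype.card (Exponents (d + 1) n) := by
  have hmem : ∀ z i, tangentVector (formsBasis (d + 1) n) (momentCoords n r (d + 1))
      (standardPoint hr z) i ∈ tangentSpace (formsBasis (d + 1) n) (momentCoords n r (d + 1))
        (standardPoint hr z) := fun z i => Submodule.subset_span ⟨i, rfl⟩
  have hX : ∀ (m : Fin n →₀ ℕ) i, (monomial (m + Finsupp.single i 1) 1 : MvPolynomial (Fin n) ℂ) =
      X i * monomial m 1 := fun m i => by
    rw [X, monomial_mul, one_mul, add_comm]
  have hzero : ∀ m : Fin n →₀ ℕ, m.degree = 0 → (monomial m 1 : MvPolynomial (Fin n) ℂ) = 1 :=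
    fun m hm => by rw [(Finsupp.degree_eq_zero_iff m).1 hm]; rfl
  rcases hd with rfl | hd | ⟨rfl, rfl⟩
  · refine le_antisymm (secantRank_le (formsBasis (d + 1) 1) _ 1)
      (le_trans ?_ (one_le_secantRank_one hn hr d))
    rw [Fintype.card_le_one_iff]
    intro b c
    have hb := mem_exponents.1 b.2
    have hc := mem_exponents.1 c.2
    rw [Finsupp.degree_eq_sum, Fin.sum_univ_one] at hb hc
    refine Subtype.ext (Finsupp.ext fun i => ?_)
    rw [Subsingleton.elim i 0, hb, hc]
  · refine secantRank_eq_card_of_monomial_mem (standardPoint hr) fun m hm => ?_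
    obtain ⟨m, i, h1, rfl⟩ := exists_eq_add_single hm
    rcases Nat.le_one_iff_eq_zero_or_eq_one.1 hd with rfl | rfl
    · refine ⟨i, _, hmem _ (none, i), ?_⟩
      rw [coe_tangentVector_none, momentForm_standardPoint, hX, hzero m h1]
      rfl
    · obtain ⟨m, j, h2, rfl⟩ := exists_eq_add_single h1
      refine ⟨j, _, hmem _ (none, i), ?_⟩
      rw [coe_tangentVector_none, momentForm_standardPoint, hX, hX, hzero m h2]
      simp [expPart]
  · refine secantRank_eq_card_of_monomial_mem (standardPoint hr) fun m hm => ?_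
    obtain ⟨m, i, h1, rfl⟩ := exists_eq_add_single hm
    obtain ⟨m, j, h2, rfl⟩ := exists_eq_add_single h1
    obtain ⟨m, k, h3, rfl⟩ := exists_eq_add_single h2
    refine ⟨k, _, hmem _ (some i, j), ?_⟩
    rw [coe_tangentVector_some, momentForm_standardPoint, linForm_standardPoint, hX, hX, hX,
      hzero m h3]
    simp [expPart, mul_assoc]

end StandardPoint

end GaussianMoments
namespace GaussianMoments

open MvPolynomial

/-! ### The two bounds -/

section Main

theorem parameterCount_eq {n r : ℕ} (hr : r ≤ n) :
    parameterCount r n = ((n + ∑ a ∈ Finset.range r, (n - a) : ℕ) : ℝ) := by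
  have h : (∑ a ∈ Finset.range r, (n - a)) + r.choose 2 = r * n := by
    induction r with
    | zero => simp
    | succ r ih =>
      have h1 := ih (by omega)
      rw [Finset.sum_range_succ, Nat.choose_succ_left r 2 two_pos, Nat.choose_one_right, add_mul]
      omega
  have h' : ((∑ a ∈ Finset.range r, (n - a) : ℕ) : ℝ) + (r.choose 2 : ℝ) = r * n := by
    exact_mod_cast h
  rw [parameterCount]
  push_cast at h' ⊢
  linarith

variable {n d r : ℕ}

theorem exists_moment_growth (hn : 1 ≤ n) (hr : r ≤ n) :
    ∃ k, (∀ j ≤ k, secantRank (momentCoords n r (d + 1)) j =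
        j * secantRank (momentCoords n r (d + 1)) 1) ∧
      Fintype.card (Exponents (d + 1) n) ≤ k * secantRank (momentCoords n r (d + 1)) 1 +
        (secantRank (momentCoords n r (d + 1)) 1 - 1) *
          (secantRank (momentCoords n r (d + 1)) 1 - 1) ∧
      secantRank (momentCoords n r (d + 1)) (k + (secantRank (momentCoords n r (d + 1)) 1 - 1)) =
        Fintype.card (Exponents (d + 1) n) := by
  let e := formsBasis (d + 1) n
  exact exists_linear_growth (secantRank (momentCoords n r (d + 1))) _ _ (secantRank_zero e _) rfl
    (one_le_secantRank_one hn hr d) (secantRank_le e _) (secantRank_mono e _)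
    (secantRank_concave e _) fun m h hlt =>
      secantRank_eq_card_of_stationary e _ (moment_irreducible ⟨0, hn⟩ d) h hlt

theorem isNondefective_gaussianMomentVariety (hn : 1 ≤ n) (hr : r ≤ n) {m : ℕ}
    (hm : (m + (n + ∑ a ∈ Finset.range r, (n - a))) * (n + ∑ a ∈ Finset.range r, (n - a)) ≤
      Module.finrank ℂ (Forms (d + 1) n)) :
    IsNondefective m (gaussianMomentVariety (d + 1) r n) := by
  obtain ⟨k, hk, hD, -⟩ := exists_moment_growth (d := d) hn hr
  have hN := one_le_secantRank_one hn hr d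
  have hNM := secantRank_one_le (n := n) (r := r) d
  have hle := secantRank_le (formsBasis (d + 1) n) (momentCoords n r (d + 1)) m
  rw [Module.finrank_eq_card_basis (formsBasis (d + 1) n)] at hm
  rw [gaussianMomentVariety_eq]
  refine ⟨secantRank (momentCoords n r (d + 1)) 1, varietyDim_eq_secantRank_one _ _, ?_⟩
  rw [varietyDim_secantVariety, Module.finrank_eq_card_basis (formsBasis (d + 1) n)]
  set N := secantRank (momentCoords n r (d + 1)) 1
  set M := n + ∑ a ∈ Finset.range r, (n - a)
  set D := Fintype.card (Exponents (d + 1) n)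
  -- Otherwise D ≤ kN + (N-1)² < (m + N) N ≤ (m + M) M ≤ D. Only N ≤ M is needed.
  have hmk : m ≤ k := by
    by_contra! hlt
    obtain ⟨s, hs⟩ : ∃ s, N = s + 1 := ⟨N - 1, by omega⟩
    have h1 : (m + N) * N ≤ (m + M) * M := Nat.mul_le_mul (by omega) hNM
    have h2 : (k + 1) * N ≤ m * N := Nat.mul_le_mul_right _ hlt
    rw [hs, Nat.add_sub_cancel] at hD
    rw [hs] at h1 h2
    nlinarith
  have hmN := hk m hmk
  rw [hmN] at hle ⊢
  rw [min_eq_left hle]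

theorem secantVariety_gaussianMomentVariety_eq_univ {m : ℕ}
    (h : secantRank (momentCoords n r (d + 1)) m = Fintype.card (Exponents (d + 1) n)) :
    secantVariety m (gaussianMomentVariety (d + 1) r n) = Set.univ := by
  rw [gaussianMomentVariety_eq]
  exact secantVariety_eq_univ (formsBasis (d + 1) n) _ h

theorem exists_secantVariety_eq_univ (hn : 1 ≤ n) (hr : r ≤ n) :
    ∃ m, secantVariety m (gaussianMomentVariety (d + 1) r n) = Set.univ ∧
      (m - (n + ∑ a ∈ Finset.range r, (n - a))) * (n + ∑ a ∈ Finset.range r, (n - a)) ≤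
        Module.finrank ℂ (Forms (d + 1) n) := by
  -- The cases in which N = M is known; then (m - M) N ≤ kN = δ_k ≤ D for m = k + N - 1.
  by_cases hgood : r = 0 ∨ 2 ≤ n ∧ 1 ≤ r ∧ (3 ≤ d ∨ d = 2 ∧ r < n)
  · obtain ⟨k, hk, -, hk'⟩ := exists_moment_growth (d := d) hn hr
    refine ⟨_, secantVariety_gaussianMomentVariety_eq_univ hk', ?_⟩
    have hle := secantRank_le (formsBasis (d + 1) n) (momentCoords n r (d + 1)) k
    rw [hk k le_rfl] at hle
    rw [Module.finrank_eq_card_basis (formsBasis (d + 1) n), ← secantRank_one_eq hn hr hgood]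
    exact (Nat.mul_le_mul_right _ (by omega)).trans hle
  -- In the exceptional cases n summands suffice, and n ≤ M makes the truncated difference zero.
  · refine ⟨n, secantVariety_gaussianMomentVariety_eq_univ
      (secantRank_eq_card hn hr (d := d) (by omega)), ?_⟩
    rw [Nat.sub_add_eq, Nat.sub_self, Nat.zero_sub, zero_mul]
    exact Nat.zero_le _

end Main

end GaussianMoments

theorem mainTheorem10 (n d r : ℕ) (hn : 1 ≤ n) (hd : 1 ≤ d) (hr : r ≤ n) :
    (∀ m : ℕ,
      (m : ℝ) ≤ (Module.finrank ℂ (GaussianMoments.Forms d n) : ℝ)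
          / GaussianMoments.parameterCount r n - GaussianMoments.parameterCount r n →
        GaussianMoments.IsNondefective m (GaussianMoments.gaussianMomentVariety d r n)) ∧
    ∃ g : ℕ, GaussianMoments.IsGenericRank (GaussianMoments.gaussianMomentVariety d r n) g ∧
      (g : ℝ) ≤ (Module.finrank ℂ (GaussianMoments.Forms d n) : ℝ)
          / GaussianMoments.parameterCount r n + GaussianMoments.parameterCount r n := by
  obtain ⟨d, rfl⟩ : ∃ d', d = d' + 1 := ⟨d - 1, by omega⟩
  rw [GaussianMoments.parameterCount_eq hr]
  have hM : (0 : ℝ) < ((n + ∑ a ∈ Finset.range r, (n - a) : ℕ) : ℝ) :=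
    Nat.cast_pos.2 (by omega)
  constructor
  · intro m hm
    refine GaussianMoments.isNondefective_gaussianMomentVariety hn hr ?_
    rw [le_sub_iff_add_le, le_div_iff₀ hM] at hm
    exact_mod_cast hm
  · obtain ⟨m, hm, hmD⟩ := GaussianMoments.exists_secantVariety_eq_univ (d := d) hn hr
    classical
    have hex : ∃ k, GaussianMoments.secantVariety k
      (GaussianMoments.gaussianMomentVariety (d + 1) r n) = Set.univ := ⟨m, hm⟩
    refine ⟨Nat.find hex, ⟨Nat.find_spec hex, fun k hk => Nat.find_min' hex hk⟩, ?_⟩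
    have h1 : ((Nat.find hex : ℕ) : ℝ) ≤ m := Nat.cast_le.2 (Nat.find_min' hex hm)
    refine h1.trans ?_
    rw [← sub_le_iff_le_add, le_div_iff₀ hM]
    have h2 : (m : ℝ) - ((n + ∑ a ∈ Finset.range r, (n - a) : ℕ) : ℝ) ≤
        ((m - (n + ∑ a ∈ Finset.range r, (n - a)) : ℕ) : ℝ) := by
      rw [sub_le_iff_le_add]
      exact_mod_cast le_tsub_add
    refine (mul_le_mul_of_nonneg_right h2 hM.le).trans ?_
    exact_mod_cast hmD
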